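/- Let $p\ge 2$ be an even integer and $t,t'>0$. \textbf{Trace maps.} A $p$-regular trace map is a finite graph (loops and multiple edges allowed) all of whose vertices have $p$ half-edges, cyclically ordered at each vertex; its edges are given by a fixed-point-free involution of the half-edges. A root is a distinguished half-edge. Write $y<x$ if $y$ is obtained from $x$ by a nonempty sequence of switches (in a switch two edges exchange an end point), each of which increases the number of connected components by exactly one; this is the non-crossing order on the maps with given half-edges. \textbf{Distributions.} The joint distribution $\Phi$ of a pair $(a,b)$ of order $p$ assigns a real number $\Phi(x,c)$ to every $p$-regular trace map $x$ with a decoration $c$ of its vertices by the letters $a,b$; it depends only on the isomorphism class, is multiplicative over disjoint unions, and equals $1$ on the empty map. Its free cumulants are defined by $\Phi(x,c)=\sum_{y\le x}\kappa_y(c)$. The pair is free if $\kappa_x(c)=0$ whenever $x$ is connected and both letters occur in $c$. The distributions of $a$ and of $b$ are given by $x\mapsto\Phi(x,c)$ with $c$ constant, and that of $a+b$ by $x\mapsto\sum_c\Phi(x,c)$, the sum being over all decorations of $x$ (multilinearity). The $n$-th moment of a distribution is the sum of its values over all connected rooted $p$-regular trace maps with $n$ unlabelled vertices ($n\ge1$),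 and the $0$-th moment is $1$. A compactly supported probability measure on $\mathbb R$ is the law of a distribution if the two have the same moments. \textbf{Free convolution.} For compactly supported probability measures $\mu,\nu$ on $\mathbb R$, the tensorial free convolution $\mu\oplus_p\nu$ is the law of $a+b$ for free $a,b$ of order $p$ with laws $\mu$ and $\nu$; that is, such a free pair exists, and for every such pair $\mu\oplus_p\nu$ is the law of $a+b$. \textbf{Free Poisson law.} $\nu_{p,t}$ is the compactly supported probability measure on $\mathbb R$ with moments $$\int \lambda^n\,d\nu_{p,t}(\lambda)=\sum_{b=1}^{n}\frac1b\binom{n-1}{b-1}\binom{pn/2}{b-1}t^b,\qquad n\ge 1.$$ \textbf{Statement.} The free convolution of two freely independent free Poisson laws of order $p$ and parameters $t$ and $t'$ is the free Poisson law of order $p$ and parameter $t+t'$: $$\nu_{p,t}\oplus_p\nu_{p,t'}=\nu_{p,t+t'}.$$ That is, a measure on $\mathbb R$ is the tensorial free convolution of $\nu_{p,t}$ and $\nu_{p,t'}$ if and only if it is the free Poisson law of order $p$ and parameter $t+t'$. -/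

import Mathlib

open MeasureTheory

/-- A `p`-regular trace map with vertex set `V`. The half-edges are the pairs `(v, i)`; the half-edges
at a vertex `v` are cyclically ordered by `(v, i) ↦ (v, i + 1)` (addition modulo `p`), and `α` is the
fixed-point-free involution whose orbits are the edges. -/
@[ext]
structure TraceMap (p : ℕ) (V : Type) where
  α : V × Fin p → V × Fin p
  invol : ∀ h, α (α h) = h
  no_fix : ∀ h, α h ≠ h

namespace TraceMap

variable {p : ℕ} {V W : Type}

instance [Finite V] : Finite (TraceMap p V) :=
  Finite.of_injective TraceMap.α fun _ _ h => TraceMap.ext h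

/-- Two vertices are equivalent when they lie in the same connected component. -/
def component (x : TraceMap p V) : Setoid V :=
  Relation.EqvGen.setoid fun v w => ∃ i, (x.α (v, i)).1 = w

/-- The number of connected components. -/
noncomputable def numComponents (x : TraceMap p V) : ℕ := Nat.card (Quotient x.component)

def Connected (x : TraceMap p V) : Prop := x.numComponents = 1

/-- The disjoint union of two trace maps. -/
def disjUnion (x : TraceMap p V) (y : TraceMap p W) : TraceMap p (V ⊕ W) where
  α := fun h => match h with
    | (Sum.inl v, i) => (Sum.inl (x.α (v, i)).1, (x.α (v, i)).2)
    | (Sum.inr w, i) => (Sum.inr (y.α (w, i)).1, (y.α (w, i)).2)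
  invol := by
    rintro ⟨v | w, i⟩ <;> simp [x.invol, y.invol]
  no_fix := by
    rintro ⟨v | w, i⟩ h
    · exact x.no_fix (v, i) (Prod.ext (by simpa using congrArg Prod.fst h)
        (by simpa using congrArg Prod.snd h))
    · exact y.no_fix (w, i) (Prod.ext (by simpa using congrArg Prod.fst h)
        (by simpa using congrArg Prod.snd h))

/-- An isomorphism of trace maps: a bijection of half-edges that commutes with the cyclic orders at
the vertices (that is, a bijection of the vertices with a rotation at each of them) and with the
involutions. -/
structure Iso (x : TraceMap p V) (y : TraceMap p W) where
  vert : V ≃ W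
  shift : V → Fin p
  comm : ∀ h : V × Fin p,
    y.α (vert h.1, h.2 + shift h.1) = (vert (x.α h).1, (x.α h).2 + shift (x.α h).1)

/-- The action of an isomorphism on half-edges. -/
def Iso.onHalfEdge {x : TraceMap p V} {y : TraceMap p W} (e : x.Iso y) (h : V × Fin p) :
    W × Fin p := (e.vert h.1, h.2 + e.shift h.1)

open Classical in
/-- `y` and `x` differ by a switch: two edges of `x` exchange an end point. If `h`, `k` belong to
distinct edges `{h, h'}`, `{k, k'}` of `x`, these are replaced by `{k, h'}`, `{h, k'}`. -/
def IsSwitch (y x : TraceMap p V) : Prop :=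
  ∃ h k : V × Fin p, ∀ e, y.α e = Equiv.swap h k (x.α (Equiv.swap h k e))

/-- `y` is obtained from `x` by a switch and has one more connected component. -/
def Step (y x : TraceMap p V) : Prop :=
  IsSwitch y x ∧ y.numComponents = x.numComponents + 1

/-- The strict order of the non-crossing poset. -/
def Below (y x : TraceMap p V) : Prop := Relation.TransGen Step y x

/-- The order of the non-crossing poset. -/
def BelowEq (y x : TraceMap p V) : Prop := y = x ∨ Below y x

theorem numComponents_le [Finite V] (x : TraceMap p V) : x.numComponents ≤ Nat.card V :=
  Nat.card_le_card_of_surjective (Quotient.mk x.component) Quotient.mk_surjective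

theorem Below.numComponents_lt {x y : TraceMap p V} (h : Below y x) :
    x.numComponents < y.numComponents := by
  induction h with
  | single h => have := h.2; omega
  | tail _ h ih => have := h.2; omega

/-- The Moebius inverse `κ` of a function `f` on the non-crossing poset: the unique solution of
`f x = ∑ y ≤ x, κ y`. -/
noncomputable def moebiusInverse [Finite V] (f : TraceMap p V → ℝ) (x : TraceMap p V) : ℝ :=
  f x - ∑ᶠ y : {y : TraceMap p V // Below y x}, moebiusInverse f y.1
termination_by Nat.card V - x.numComponents
decreasing_by
  have h1 := y.2.numComponents_lt
  have h2 := y.1.numComponents_le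
  omega

theorem eq_sum_moebiusInverse [Finite V] (f : TraceMap p V → ℝ) (x : TraceMap p V) :
    f x = ∑ᶠ y ∈ {y : TraceMap p V | BelowEq y x}, moebiusInverse f y := by
  have hset : {y : TraceMap p V | BelowEq y x} = insert x {y | Below y x} := rfl
  have hx : x ∉ {y : TraceMap p V | Below y x} := fun h =>
    lt_irrefl _ (Below.numComponents_lt h)
  rw [hset, finsum_mem_insert _ hx (Set.toFinite _), moebiusInverse]
  rw [← finsum_set_coe_eq_finsum_mem]
  exact (sub_add_cancel _ _).symm

end TraceMap

/-- The joint distribution of a family, indexed by `ι`, of (abstract) tensors of order `p`: to every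
`p`-regular trace map whose vertices are decorated by members of the family it assigns a number
that depends on the isomorphism class only, is multiplicative over disjoint unions, and is `1` on the
empty map. It extends to linear combinations of the members by multilinearity. -/
structure TensorDistribution (p : ℕ) (ι : Type) where
  val : ∀ {V : Type} [Finite V], TraceMap p V → (V → ι) → ℝ
  iso_inv : ∀ {V W : Type} [Finite V] [Finite W] (x : TraceMap p V) (y : TraceMap p W)
    (e : x.Iso y) (c : W → ι), val x (fun v => c (e.vert v)) = val y c
  val_empty : ∀ {V : Type} [Finite V] [IsEmpty V] (x : TraceMap p V) (c : V → ι), val x c = 1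
  val_disjUnion : ∀ {V W : Type} [Finite V] [Finite W] (x : TraceMap p V) (y : TraceMap p W)
    (c : V → ι) (d : W → ι), val (x.disjUnion y) (Sum.elim c d) = val x c * val y d

/-- A rooted connected `p`-regular trace map with vertices labelled by `Fin n`; the root is a
half-edge. -/
structure RootedMap (p n : ℕ) where
  map : TraceMap p (Fin n)
  root : Fin n × Fin p
  connected : map.Connected

/-- The set of connected rooted `p`-regular trace maps with `n` unlabelled vertices: rooted maps up to
the isomorphisms that preserve the root. -/
def RootedClass (p n : ℕ) : Type :=
  Quot fun x y : RootedMap p n => ∃ e : x.map.Iso y.map, e.onHalfEdge x.root = y.root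

namespace TensorDistribution

variable {p : ℕ} {ι : Type}

/-- The distribution of the member `i` of the family. -/
def marginal (Φ : TensorDistribution p ι) (i : ι) : TensorDistribution p Unit where
  val := fun x _ => Φ.val x fun _ => i
  iso_inv := fun x y e _ => Φ.iso_inv x y e fun _ => i
  val_empty := fun x _ => Φ.val_empty x _
  val_disjUnion := fun x y _ _ => by
    rw [← Φ.val_disjUnion]
    congr 1
    funext v
    cases v <;> rfl

/-- The distribution of the sum of the members of the family, expanded by multilinearity. -/
noncomputable def total [Finite ι] (Φ : TensorDistribution p ι) : TensorDistribution p Unit where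
  val := fun {V} _ x _ => ∑ᶠ c : V → ι, Φ.val x c
  iso_inv := fun {V W} _ _ x y e _ => by
    rw [← finsum_comp_equiv (e.vert.arrowCongr (Equiv.refl ι))]
    refine finsum_congr fun c => ?_
    rw [← Φ.iso_inv x y e]
    congr 1
    funext v
    simp [Equiv.arrowCongr]
  val_empty := fun {V} _ _ x _ => by
    rw [finsum_eq_single _ (fun v => isEmptyElim v) fun c hc => (hc (Subsingleton.elim _ _)).elim]
    exact Φ.val_empty x _
  val_disjUnion := fun {V W} _ _ x y _ _ => by
    classical
    have := Fintype.ofFinite ι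
    have := Fintype.ofFinite V
    have := Fintype.ofFinite W
    rw [← finsum_comp_equiv (Equiv.sumArrowEquivProdArrow V W ι).symm]
    simp only [finsum_eq_sum_of_fintype]
    rw [Fintype.sum_mul_sum, Fintype.sum_prod_type]
    exact Finset.sum_congr rfl fun c _ => Finset.sum_congr rfl fun d _ => Φ.val_disjUnion x y c d

/-- The free cumulant `κ_x` of the decorated map `(x, c)`: `Φ x c = ∑ y ≤ x, κ_y c`. -/
noncomputable def freeCumulant (Φ : TensorDistribution p ι) {V : Type} [Finite V]
    (x : TraceMap p V) (c : V → ι) : ℝ :=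
  TraceMap.moebiusInverse (fun y => Φ.val y c) x

/-- Freeness (for tensors of even order): all mixed free cumulants vanish. -/
def IsFree (Φ : TensorDistribution p ι) : Prop :=
  ∀ (V : Type) [Finite V] (x : TraceMap p V) (c : V → ι),
    x.Connected → (∃ v w, c v ≠ c w) → Φ.freeCumulant x c = 0

/-- The value of a distribution on a connected rooted unlabelled map. -/
def evalClass (a : TensorDistribution p Unit) {n : ℕ} (b : RootedClass p n) : ℝ :=
  Quot.lift (fun x : RootedMap p n => a.val x.map fun _ => ())
    (fun x y h => by obtain ⟨e, -⟩ := h; exact a.iso_inv x.map y.map e fun _ => ()) b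

/-- The `n`-th moment: the sum over all connected rooted maps with `n` unlabelled vertices. -/
noncomputable def moment (a : TensorDistribution p Unit) (n : ℕ) : ℝ :=
  if n = 0 then 1 else ∑ᶠ b : RootedClass p n, a.evalClass b

end TensorDistribution

/-- A compactly supported probability measure on the real line. -/
def IsCompactlySupportedProb (μ : Measure ℝ) : Prop :=
  IsProbabilityMeasure μ ∧ ∃ M : ℝ, μ (Set.Icc (-M) M) = 1

/-- `μ` is the compactly supported probability measure with the moments of the distribution `a`. -/
def TensorDistribution.HasLaw {p : ℕ} (a : TensorDistribution p Unit) (μ : Measure ℝ) : Prop :=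
  IsCompactlySupportedProb μ ∧ ∀ n : ℕ, ∫ x, x ^ n ∂μ = a.moment n

/-- `ρ` is the tensorial free convolution of `μ` and `ν` at order `p`: there are free distributions
`a`, `b` of order `p` with laws `μ`, `ν`, and for all of them `ρ` is the law of `a + b`. -/
def IsTensorFreeConvolution (p : ℕ) (μ ν ρ : Measure ℝ) : Prop :=
  (∃ Φ : TensorDistribution p (Fin 2),
    Φ.IsFree ∧ (Φ.marginal 0).HasLaw μ ∧ (Φ.marginal 1).HasLaw ν) ∧
  ∀ Φ : TensorDistribution p (Fin 2),
    Φ.IsFree → (Φ.marginal 0).HasLaw μ → (Φ.marginal 1).HasLaw ν → Φ.total.HasLaw ρ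

/-- The `n`-th Fuss-Narayana polynomial of order `q`, evaluated at `t`. -/
noncomputable def fussNarayana (q n : ℕ) (t : ℝ) : ℝ :=
  ∑ b ∈ Finset.Icc 1 n,
    (1 / (b : ℝ)) * ((n - 1).choose (b - 1) : ℝ) * ((q * n).choose (b - 1) : ℝ) * t ^ b

/-- `μ` is the free Poisson law of even order `p` and parameter `t`: the compactly supported
probability measure whose moments are the Fuss-Narayana polynomials of order `p / 2` at `t`. -/
def IsFreePoissonLaw (p : ℕ) (t : ℝ) (μ : Measure ℝ) : Prop :=
  IsCompactlySupportedProb μ ∧ ∀ n : ℕ, 1 ≤ n → ∫ x, x ^ n ∂μ = fussNarayana (p / 2) n t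

/-! ### Switches and connected components -/

namespace TraceMap

open Classical

variable {p : ℕ} {V W : Type}

/-! The moments of a distribution turn out to depend on its free cumulants only through one power
series, and that series is additive for free sums. Let `A` have coefficient `(p n / n!) ∑ κ_y` at `X
^ n`, the sum being over the connected maps `y` on `n` labelled vertices (`cumulantSeries`).

The reason is a count. For any map `y` on `n` vertices with components of sizes `n_1, ..., n_b`, the
number `N` of connected maps above `y` satisfies `p n N = (p n_1) ⋯ (p n_b) · (pn/2)(pn/2 - 1)⋯(pn/2
- b + 2)` (`card_connected_above`), so it depends on component sizes alone. To prove this, write the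
relation `y ≤ x`, for connected `x`, without chains of switches: the edges of `x` link all
components of `y`, and the number of alternating cycles of `x` and `y` (`jointRank`) is at least the
number of edges minus `b - 1`, the largest value that linkage permits. Such tree-like gluings are
counted by recursion on the edges of `y` (`card_glued_rec`, `card_glued`).

Summing `Φ x = ∑ κ_y` over connected `x`, exchanging the sums, and applying the exponential formula
to the components of `y` gives `p ^ n m_n = ∑_b (pn/2)(pn/2 - 1)⋯(pn/2 - b + 2) / b! · [X ^ n] A ^
b` (`moment_eq_momentSum`). The term `b = 1` is the `n`-th coefficient of `A` and the others involve
only earlier coefficients, so moments and `A` determine each other. The Fuss-Narayana moments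
correspond exactly to `A = t ∑_{n ≥ 1} (p X) ^ n` (`moments_eq_fussNarayana_iff`), which is linear
in `t`. For a free pair the mixed cumulants vanish, so the series add (`cumulantSeries_total`), and
so do the parameters.

A free pair with the prescribed laws is obtained by prescribing cumulants: zero on a connected map
with mixed letters, and otherwise the same value on all connected maps of a given size (`poisson`).
-/

theorem component_rel (x : TraceMap p V) (h : V × Fin p) : x.component h.1 (x.α h).1 :=
  Relation.EqvGen.rel _ _ ⟨h.2, rfl⟩

theorem component_le_iff (x : TraceMap p V) (r : Setoid V) :
    x.component ≤ r ↔ ∀ h, r h.1 (x.α h).1 := by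
  constructor
  · intro H h
    exact H (x.component_rel h)
  · intro H
    refine Setoid.eqvGen_le ?_
    rintro v w ⟨i, rfl⟩
    exact H (v, i)

theorem α_injective (x : TraceMap p V) : Function.Injective x.α :=
  Function.LeftInverse.injective x.invol

theorem α_eq_iff (x : TraceMap p V) {h k : V × Fin p} : x.α h = k ↔ x.α k = h :=
  ⟨fun e => by rw [← e, x.invol], fun e => by rw [← e, x.invol]⟩

/-- Exchange the end points `h` and `k` of two edges. -/
noncomputable def switch (x : TraceMap p V) (h k : V × Fin p) : TraceMap p V where
  α e := Equiv.swap h k (x.α (Equiv.swap h k e))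
  invol e := by simp [x.invol]
  no_fix e he := x.no_fix (Equiv.swap h k e) (by
    rw [Equiv.swap_apply_eq_iff] at he
    exact he)

theorem switch_α [inst : DecidableEq (V × Fin p)] (x : TraceMap p V) (h k e : V × Fin p) :
    (x.switch h k).α e = Equiv.swap h k (x.α (Equiv.swap h k e)) := by
  rw [Subsingleton.elim inst fun a b => instDecidableEqProd a b]
  rfl

@[simp] theorem switch_switch (x : TraceMap p V) (h k : V × Fin p) :
    (x.switch h k).switch h k = x := by
  ext1; funext e; simp [switch_α]

theorem isSwitch_iff (y x : TraceMap p V) : IsSwitch y x ↔ ∃ h k, y = x.switch h k := by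
  constructor
  · rintro ⟨h, k, H⟩
    exact ⟨h, k, TraceMap.ext (funext H)⟩
  · rintro ⟨h, k, rfl⟩
    exact ⟨h, k, fun _ => rfl⟩

theorem switch_comm (x : TraceMap p V) (h k : V × Fin p) : x.switch h k = x.switch k h := by
  ext1; funext e; simp [switch_α, Equiv.swap_comm h k]

theorem switch_α_left (x : TraceMap p V) {h k : V × Fin p} (hk : x.α h ≠ k) :
    (x.switch h k).α h = x.α k := by
  rw [switch_α, Equiv.swap_apply_left, Equiv.swap_apply_of_ne_of_ne _ (x.no_fix k)]
  exact fun e => hk (x.α_eq_iff.1 e)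

theorem switch_α_of_ne (x : TraceMap p V) {h k e : V × Fin p} (h1 : e ≠ h) (h2 : e ≠ k)
    (h3 : x.α e ≠ h) (h4 : x.α e ≠ k) : (x.switch h k).α e = x.α e := by
  rw [switch_α, Equiv.swap_apply_of_ne_of_ne h1 h2, Equiv.swap_apply_of_ne_of_ne h3 h4]

theorem switch_component_le (x : TraceMap p V) (h k : V × Fin p) (r : Setoid V)
    (hx : x.component ≤ r) (hr : r h.1 k.1) : (x.switch h k).component ≤ r := by
  rw [component_le_iff] at hx ⊢
  have key : ∀ e : V × Fin p, r e.1 (Equiv.swap h k e).1 := by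
    intro e
    rcases eq_or_ne e h with rfl | h1
    · simpa using hr
    rcases eq_or_ne e k with rfl | h2
    · simpa using r.symm hr
    rw [Equiv.swap_apply_of_ne_of_ne h1 h2]
  intro e
  exact r.trans (r.trans (key e) (hx _)) (key _)

/-- An involution of a finite set of even size without fixed points cannot leave the set at exactly
one element. -/
theorem even_card_no_single_exit {H : Type*} (T : Finset H) (f : H → H) (hf : ∀ a, f (f a) = a)
    (hne : ∀ a, f a ≠ a) (h : H) (hT : h ∈ T) (hout : f h ∉ T)
    (hin : ∀ a ∈ T, a ≠ h → f a ∈ T) : ¬ Even T.card := by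
  have h1 : Even (T.erase h).card := by
    -- A fixed-point-free involution makes the sum of ones vanish modulo 2, and `f h ∉ T` lets `f`
    -- preserve `T` without `h`.
    have := Finset.sum_involution (s := T.erase h) (f := fun _ => (1 : ZMod 2))
      (fun a _ => f a) (fun _ _ => by decide) (fun a _ _ => hne a)
      (fun a ha => by
        rw [Finset.mem_erase] at ha ⊢
        refine ⟨fun e => ?_, hin a ha.2 ha.1⟩
        apply hout
        rw [← e, hf]; exact ha.2) (fun a _ => hf a)
    rw [Finset.sum_const, nsmul_eq_mul, mul_one] at this
    exact (ZMod.natCast_eq_zero_iff_even).1 this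
  have h2 := Finset.card_erase_add_one hT
  rw [← h2]
  exact Nat.not_even_iff_odd.2 h1.add_one

/-- An even regular graph has no bridge. If the cut edge at `h` separated its two ends, the vertices
still joined to `h` inside its old component would carry an even number of half-edges, yet be left
by `x.α` only at `h`. -/
theorem switch_component_left [Finite V] (hp : Even p) (x : TraceMap p V) {h k : V × Fin p}
    (hk : ¬ x.component h.1 k.1) : (x.switch h k).component h.1 (x.α h).1 := by
  have := Fintype.ofFinite V
  by_contra hcon
  set y := x.switch h k with hy
  have hne : x.α h ≠ k := by
    rintro rfl; exact hk (x.component_rel h)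
  let C : Finset V := Finset.univ.filter fun v => y.component h.1 v ∧ x.component h.1 v
  have hcard : Even ((C ×ˢ (Finset.univ : Finset (Fin p))).card) := by
    rw [Finset.card_product]; simpa using hp.mul_left _
  refine even_card_no_single_exit _ x.α x.invol x.no_fix h ?_ ?_ ?_ hcard
  · simp [C, Setoid.refl]
  · simp only [C, Finset.mem_product, Finset.mem_filter, Finset.mem_univ, true_and, and_true]
    exact fun H => hcon H.1
  · intro a ha hah
    simp only [C, Finset.mem_product, Finset.mem_filter, Finset.mem_univ, true_and, and_true]
      at ha ⊢
    refine ⟨?_, x.component.trans ha.2 (x.component_rel a)⟩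
    have e : y.α a = x.α a := by
      apply switch_α_of_ne _ hah
      · rintro rfl; exact hk ha.2
      · intro e
        apply hcon
        have : x.α h = a := x.α_eq_iff.1 e
        rw [this]; exact ha.1
      · intro e
        apply hk
        rw [← e]; exact x.component.trans ha.2 (x.component_rel a)
    rw [← e]
    exact y.component.trans ha.1 (y.component_rel a)

/-- Only the two cut edges could be lost, and neither is a bridge, so their ends stay joined. -/
theorem le_switch_component [Finite V] (hp : Even p) (x : TraceMap p V) {h k : V × Fin p}
    (hk : ¬ x.component h.1 k.1) : x.component ≤ (x.switch h k).component := by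
  have hk' : ¬ x.component k.1 h.1 := fun e => hk (x.component.symm e)
  have h1 := x.switch_component_left hp hk
  have h2 := x.switch_component_left hp hk'
  rw [switch_comm] at h2
  rw [component_le_iff]
  intro e
  rcases eq_or_ne e h with rfl | n1
  · exact h1
  rcases eq_or_ne e k with rfl | n2
  · exact h2
  rcases eq_or_ne (x.α e) h with n3 | n3
  · rw [← n3, x.invol, n3] at h1
    rw [n3]; exact Setoid.symm' _ h1
  rcases eq_or_ne (x.α e) k with n4 | n4
  · rw [← n4, x.invol, n4] at h2
    rw [n4]; exact Setoid.symm' _ h2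
  rw [← switch_α_of_ne x n1 n2 n3 n4]
  exact component_rel _ e

theorem switch_component_rel [Finite V] (hp : Even p) (x : TraceMap p V) {h k : V × Fin p}
    (hk : ¬ x.component h.1 k.1) : (x.switch h k).component h.1 k.1 := by
  have h1 := le_switch_component hp x hk (x.component_rel k)
  have h2 := (x.switch h k).component_rel h
  rw [switch_α_left] at h2
  · exact Setoid.trans' _ h2 (Setoid.symm' _ h1)
  · rintro rfl; exact hk (x.component_rel h)

/-- Joining two classes of a setoid decreases the number of classes by one. -/
theorem card_quotient_join [Finite V] (r s : Setoid V) (a b : V) (hrs : r ≤ s) (hab : s a b)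
    (hnot : ¬ r a b) (hs : ∀ u : Setoid V, r ≤ u → u a b → s ≤ u) :
    Nat.card (Quotient r) = Nat.card (Quotient s) + 1 := by
  -- The class of `b` is identified with that of `a`. By minimality of `s`, the fibres of `g`
  -- contain the classes of `s`.
  let g : V → Quotient r := fun v => if r v b then ⟦a⟧ else ⟦v⟧
  have hg : ∀ v w, s v w → g v = g w := by
    intro v w h
    refine (hs (Setoid.ker g) ?_ ?_) h
    · intro v w hvw
      rw [Setoid.ker_def]
      simp only [g]
      have : r v b ↔ r w b := ⟨r.trans (r.symm hvw), r.trans hvw⟩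
      simp only [this]
      split_ifs
      · rfl
      · exact Quotient.sound hvw
    · rw [Setoid.ker_def]
      simp only [g]
      rw [if_neg hnot, if_pos (r.refl b)]
  have e : Quotient r ≃ Option (Quotient s) := {
    toFun := Quotient.lift (fun v => if r v b then none else some (Quotient.mk s v)) (by
      intro v w hvw
      have hvw : r v w := hvw
      have : r v b ↔ r w b := ⟨r.trans (r.symm hvw), r.trans hvw⟩
      simp only [this]
      split_ifs
      · rfl
      · exact congrArg some (Quotient.sound (hrs hvw)))
    invFun := fun o => o.elim ⟦b⟧ (Quotient.lift g hg)
    left_inv := by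
      intro q
      induction q using Quotient.inductionOn with | _ v
      by_cases h : r v b
      · simpa [h] using Quotient.sound (r.symm h)
      · simp [h, g]
    right_inv := by
      intro o
      rcases o with _ | q
      · simp
      · induction q using Quotient.inductionOn with | _ v
        by_cases h : r v b
        · simpa [h, g, hnot] using Quotient.sound (s.trans hab (s.symm (hrs h)))
        · simp [h, g] }
  rw [Nat.card_congr e, Finite.card_option]

theorem numComponents_switch [Finite V] (hp : Even p) (x : TraceMap p V) {h k : V × Fin p}
    (hk : ¬ x.component h.1 k.1) :
    x.numComponents = (x.switch h k).numComponents + 1 :=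
  card_quotient_join _ _ h.1 k.1 (le_switch_component hp x hk) (switch_component_rel hp x hk) hk
    fun _ hu hab => switch_component_le x h k _ hu hab

theorem step_switch [Finite V] (hp : Even p) (x : TraceMap p V) {h k : V × Fin p}
    (hk : ¬ x.component h.1 k.1) : Step x (x.switch h k) :=
  ⟨(isSwitch_iff _ _).2 ⟨h, k, by simp⟩, numComponents_switch hp x hk⟩

/-- A switch between two different components merges them and lowers the count, so a step must act
inside a single component. -/
theorem Step.component_le [Finite V] (hp : Even p) {y x : TraceMap p V} (hs : Step y x) :
    y.component ≤ x.component := by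
  obtain ⟨h1, h2⟩ := hs
  obtain ⟨h, k, rfl⟩ := (isSwitch_iff _ _).1 h1
  by_cases hk : x.component h.1 k.1
  · exact switch_component_le x h k _ le_rfl hk
  · have := numComponents_switch hp x hk
    omega

theorem belowEq_iff {y x : TraceMap p V} : BelowEq y x ↔ Relation.ReflTransGen Step y x := by
  rw [Relation.reflTransGen_iff_eq_or_transGen, BelowEq, Below, eq_comm]

theorem BelowEq.component_le [Finite V] (hp : Even p) {y x : TraceMap p V} (h : BelowEq y x) :
    y.component ≤ x.component := by
  rw [belowEq_iff] at h
  induction h with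
  | refl => exact le_rfl
  | tail _ h ih => exact ih.trans (h.component_le hp)

theorem BelowEq.refl (x : TraceMap p V) : BelowEq x x := Or.inl rfl

theorem BelowEq.trans {x y z : TraceMap p V} (h : BelowEq x y) (h' : BelowEq y z) :
    BelowEq x z := by
  rw [belowEq_iff] at *
  exact Relation.ReflTransGen.trans h h'

/-! ### Relabelling of half-edges -/

/-- The half-edges are relabelled by a bijection of the vertices and a rotation at each vertex. -/
def halfEdgeEquiv [NeZero p] (e : V ≃ W) (s : V → Fin p) : V × Fin p ≃ W × Fin p where
  toFun h := (e h.1, h.2 + s h.1)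
  invFun k := (e.symm k.1, k.2 - s (e.symm k.1))
  left_inv h := by simp
  right_inv k := by simp

/-- Transport of a trace map along a relabelling of the half-edges. -/
def relabel [NeZero p] (e : V ≃ W) (s : V → Fin p) : TraceMap p V ≃ TraceMap p W where
  toFun x :=
    { α := fun k => halfEdgeEquiv e s (x.α ((halfEdgeEquiv e s).symm k))
      invol := fun k => by simp [x.invol]
      no_fix := fun k hk => x.no_fix ((halfEdgeEquiv e s).symm k) (by
        rw [Equiv.eq_symm_apply]; exact hk) }
  invFun y :=
    { α := fun k => (halfEdgeEquiv e s).symm (y.α (halfEdgeEquiv e s k))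
      invol := fun k => by simp [y.invol]
      no_fix := fun k hk => y.no_fix (halfEdgeEquiv e s k) (by
        rw [Equiv.symm_apply_eq] at hk; exact hk) }
  left_inv x := by ext1; funext k; simp
  right_inv x := by ext1; funext k; simp

section relabel

variable [NeZero p] (e : V ≃ W) (s : V → Fin p)

theorem relabel_α (x : TraceMap p V) (h : V × Fin p) :
    (relabel e s x).α (halfEdgeEquiv e s h) = halfEdgeEquiv e s (x.α h) := by
  simp [relabel]

/-- The isomorphism onto the relabelled trace map. -/
def relabelIso (x : TraceMap p V) : x.Iso (relabel e s x) where
  vert := e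
  shift := s
  comm h := relabel_α e s x h

theorem Iso.eq_relabel {x : TraceMap p V} {y : TraceMap p W} (e : x.Iso y) :
    y = relabel e.vert e.shift x := by
  ext1; funext k
  obtain ⟨h, rfl⟩ := (halfEdgeEquiv e.vert e.shift).surjective k
  rw [relabel_α]
  exact e.comm h

theorem relabel_component (x : TraceMap p V) (v w : V) :
    (relabel e s x).component (e v) (e w) ↔ x.component v w := by
  constructor
  · intro h
    have : (relabel e s x).component ≤ Setoid.comap e.symm x.component := by
      rw [component_le_iff]
      intro k
      obtain ⟨h, rfl⟩ := (halfEdgeEquiv e s).surjective k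
      rw [relabel_α]
      simpa [Setoid.comap_rel, halfEdgeEquiv] using x.component_rel h
    simpa [Setoid.comap_rel] using this h
  · intro h
    have : x.component ≤ Setoid.comap e (relabel e s x).component := by
      rw [component_le_iff]
      intro k
      rw [Setoid.comap_rel]
      have := (relabel e s x).component_rel (halfEdgeEquiv e s k)
      rw [relabel_α] at this
      exact this
    exact this h

/-- Relabelling induces a bijection of the components. -/
def relabelComponents (x : TraceMap p V) :
    Quotient x.component ≃ Quotient (relabel e s x).component :=
  Quotient.congr e fun v w => (relabel_component e s x v w).symm

theorem numComponents_relabel (x : TraceMap p V) :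
    (relabel e s x).numComponents = x.numComponents :=
  (Nat.card_congr (relabelComponents e s x)).symm

theorem relabel_switch (x : TraceMap p V) (h k : V × Fin p) :
    relabel e s (x.switch h k) =
      (relabel e s x).switch (halfEdgeEquiv e s h) (halfEdgeEquiv e s k) := by
  ext1; funext a
  obtain ⟨a, rfl⟩ := (halfEdgeEquiv e s).surjective a
  have key : ∀ b, Equiv.swap (halfEdgeEquiv e s h) (halfEdgeEquiv e s k) (halfEdgeEquiv e s b) =
      halfEdgeEquiv e s (Equiv.swap h k b) := fun b =>
    ((halfEdgeEquiv e s).injective.map_swap h k b).symm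
  rw [relabel_α, switch_α, switch_α, key, relabel_α, key]

theorem step_relabel {y x : TraceMap p V} (h : Step y x) :
    Step (relabel e s y) (relabel e s x) := by
  obtain ⟨h1, h2⟩ := h
  obtain ⟨h, k, rfl⟩ := (isSwitch_iff _ _).1 h1
  exact ⟨(isSwitch_iff _ _).2 ⟨_, _, relabel_switch e s x h k⟩, by
    rw [numComponents_relabel, numComponents_relabel, h2]⟩

theorem step_of_relabel {y x : TraceMap p V} (h : Step (relabel e s y) (relabel e s x)) :
    Step y x := by
  obtain ⟨h1, h2⟩ := h
  obtain ⟨h, k, hk⟩ := (isSwitch_iff _ _).1 h1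
  obtain ⟨h, rfl⟩ := (halfEdgeEquiv e s).surjective h
  obtain ⟨k, rfl⟩ := (halfEdgeEquiv e s).surjective k
  rw [← relabel_switch] at hk
  rw [numComponents_relabel, numComponents_relabel] at h2
  exact ⟨(isSwitch_iff _ _).2 ⟨_, _, (relabel e s).injective hk⟩, h2⟩

theorem belowEq_relabel {y x : TraceMap p V} :
    BelowEq (relabel e s y) (relabel e s x) ↔ BelowEq y x := by
  rw [belowEq_iff, belowEq_iff]
  constructor
  · intro h
    have := Relation.ReflTransGen.lift (relabel e s).symm (p := Step) (fun a b hab =>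
      step_of_relabel e s (y := (relabel e s).symm a) (x := (relabel e s).symm b)
        (by simpa using hab)) _ _ h
    simpa [Function.onFun] using this
  · exact Relation.ReflTransGen.lift (relabel e s) (fun a b hab => step_relabel e s hab) _ _

end relabel

end TraceMap

/-! ### Möbius inversion on the non-crossing poset -/

namespace TraceMap

open Classical

variable {p : ℕ} {V W : Type}

noncomputable instance instFintype [Finite V] : Fintype (TraceMap p V) := Fintype.ofFinite _

/-- The sum over the lower set of `x` in the non-crossing poset. -/
noncomputable def lowerSum [Finite V] (g : TraceMap p V → ℝ) (x : TraceMap p V) : ℝ :=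
  ∑ y with BelowEq y x, g y

theorem eq_lowerSum_moebiusInverse [Finite V] (f : TraceMap p V → ℝ) (x : TraceMap p V) :
    f x = lowerSum (moebiusInverse f) x := by
  conv_lhs => rw [eq_sum_moebiusInverse f x]
  rw [finsum_mem_eq_toFinset_sum]
  exact Finset.sum_congr (by ext; simp) fun _ _ => rfl

theorem BelowEq.lt_or_eq {y x : TraceMap p V} [Finite V] (h : BelowEq y x) :
    y = x ∨ x.numComponents < y.numComponents :=
  h.imp id fun h => h.numComponents_lt

/-- Elements strictly below `y` have more components, so induction on the number of missing
components applies. The identity is required only below `x`: this local form suits a candidate `g`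
that is understood only there. -/
theorem moebiusInverse_unique_of_le [Finite V] (f g : TraceMap p V → ℝ) (x : TraceMap p V)
    (h : ∀ y, BelowEq y x → f y = lowerSum g y) : moebiusInverse f x = g x := by
  have key : ∀ n : ℕ, ∀ y, BelowEq y x → Nat.card V - y.numComponents ≤ n →
      moebiusInverse f y = g y := by
    intro n
    induction n using Nat.strong_induction_on with | _ n ih
    intro y hy hn
    have h1 := h y hy
    rw [eq_lowerSum_moebiusInverse f y] at h1
    simp only [lowerSum] at h1
    rw [← sub_eq_zero, ← Finset.sum_sub_distrib, Finset.sum_eq_single y] at h1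
    · linarith
    · intro z hz hzy
      simp only [Finset.mem_filter, Finset.mem_univ, true_and] at hz
      have hlt := hz.lt_or_eq.resolve_left hzy
      have := numComponents_le z
      rw [ih (n - 1) (by omega) z (hz.trans hy) (by omega), sub_self]
    · intro hy'
      exact (hy' (by simp [BelowEq.refl])).elim
  exact key _ x (BelowEq.refl x) le_rfl

theorem moebiusInverse_lowerSum [Finite V] (g : TraceMap p V → ℝ) (x : TraceMap p V) :
    moebiusInverse (lowerSum g) x = g x :=
  moebiusInverse_unique_of_le _ _ _ fun _ _ => rfl

theorem moebiusInverse_sum [Finite V] {ι : Type*} (s : Finset ι) (f : ι → TraceMap p V → ℝ)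
    (x : TraceMap p V) :
    moebiusInverse (fun y => ∑ i ∈ s, f i y) x = ∑ i ∈ s, moebiusInverse (f i) x := by
  refine moebiusInverse_unique_of_le _ (fun y => ∑ i ∈ s, moebiusInverse (f i) y) _ fun y _ => ?_
  simp only [lowerSum]
  rw [Finset.sum_comm]
  exact Finset.sum_congr rfl fun i _ => eq_lowerSum_moebiusInverse (f i) y

theorem lowerSum_relabel [NeZero p] [Finite V] [Finite W] (e : V ≃ W) (s : V → Fin p)
    (g : TraceMap p W → ℝ) (x : TraceMap p V) :
    lowerSum g (relabel e s x) = lowerSum (fun y => g (relabel e s y)) x := by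
  simp only [lowerSum]
  symm
  refine Finset.sum_bij (fun y _ => relabel e s y) ?_ (fun _ _ _ _ h => (relabel e s).injective h)
    ?_ fun _ _ => rfl
  · intro y hy
    simpa [belowEq_relabel] using hy
  · intro y hy
    refine ⟨(relabel e s).symm y, ?_, by simp⟩
    rw [Finset.mem_filter] at hy ⊢
    rw [← belowEq_relabel e s]
    simpa using hy

theorem moebiusInverse_relabel [NeZero p] [Finite V] [Finite W] (e : V ≃ W) (s : V → Fin p)
    (f : TraceMap p W → ℝ) (x : TraceMap p V) :
    moebiusInverse f (relabel e s x) = moebiusInverse (fun y => f (relabel e s y)) x := by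
  refine (moebiusInverse_unique_of_le _ (fun y => moebiusInverse f (relabel e s y)) x
    fun y _ => ?_).symm
  rw [eq_lowerSum_moebiusInverse f, lowerSum_relabel]

/-! ### Lower sets and Möbius inverses of disjoint unions -/

section disjUnion

theorem disjUnion_α_inl (x : TraceMap p V) (y : TraceMap p W) (h : V × Fin p) :
    (x.disjUnion y).α (Sum.inl h.1, h.2) = (Sum.inl (x.α h).1, (x.α h).2) := rfl

theorem disjUnion_α_inr (x : TraceMap p V) (y : TraceMap p W) (h : W × Fin p) :
    (x.disjUnion y).α (Sum.inr h.1, h.2) = (Sum.inr (y.α h).1, (y.α h).2) := rfl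

theorem disjUnion_injective {x x' : TraceMap p V} {y y' : TraceMap p W}
    (h : x.disjUnion y = x'.disjUnion y') : x = x' ∧ y = y' := by
  constructor
  · ext1; funext a
    have := congrArg (fun z => z.α (Sum.inl a.1, a.2)) h
    simp only [disjUnion_α_inl, Prod.mk.injEq, Sum.inl.injEq] at this
    exact Prod.ext this.1 this.2
  · ext1; funext a
    have := congrArg (fun z => z.α (Sum.inr a.1, a.2)) h
    simp only [disjUnion_α_inr, Prod.mk.injEq, Sum.inr.injEq] at this
    exact Prod.ext this.1 this.2

theorem exists_eq_disjUnion (z : TraceMap p (V ⊕ W))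
    (hz : ∀ h, (z.α h).1.isLeft = h.1.isLeft) :
    ∃ (x : TraceMap p V) (y : TraceMap p W), z = x.disjUnion y := by
  have h1 : ∀ h : V × Fin p, ∃ k : V × Fin p, z.α (Sum.inl h.1, h.2) = (Sum.inl k.1, k.2) := by
    intro h
    obtain ⟨v, hv⟩ := Sum.isLeft_iff.1 (hz (Sum.inl h.1, h.2))
    exact ⟨(v, (z.α (Sum.inl h.1, h.2)).2), Prod.ext hv rfl⟩
  have h2 : ∀ h : W × Fin p, ∃ k : W × Fin p, z.α (Sum.inr h.1, h.2) = (Sum.inr k.1, k.2) := by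
    intro h
    have := hz (Sum.inr h.1, h.2)
    obtain ⟨v, hv⟩ := Sum.isRight_iff.1 (Sum.isLeft_eq_false.1 this)
    exact ⟨(v, (z.α (Sum.inr h.1, h.2)).2), Prod.ext hv rfl⟩
  choose a ha using h1
  choose b hb using h2
  refine ⟨⟨a, fun h => ?_, fun h e => ?_⟩, ⟨b, fun h => ?_, fun h e => ?_⟩, ?_⟩
  · have := z.invol (Sum.inl h.1, h.2)
    rw [ha, ha] at this
    simp only [Prod.mk.injEq, Sum.inl.injEq] at this
    exact Prod.ext this.1 this.2
  · apply z.no_fix (Sum.inl h.1, h.2)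
    rw [ha, e]
  · have := z.invol (Sum.inr h.1, h.2)
    rw [hb, hb] at this
    simp only [Prod.mk.injEq, Sum.inr.injEq] at this
    exact Prod.ext this.1 this.2
  · apply z.no_fix (Sum.inr h.1, h.2)
    rw [hb, e]
  · ext1; funext k
    rcases k with ⟨v | w, i⟩
    · exact ha (v, i)
    · exact hb (w, i)

theorem disjUnion_component (x : TraceMap p V) (y : TraceMap p W) :
    (x.disjUnion y).component =
      Setoid.ker (Sum.map (Quotient.mk x.component) (Quotient.mk y.component)) := by
  apply le_antisymm
  · rw [component_le_iff]
    rintro ⟨v | w, i⟩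
    · rw [Setoid.ker_def]
      exact congrArg Sum.inl (Quotient.sound (x.component_rel (v, i)))
    · rw [Setoid.ker_def]
      exact congrArg Sum.inr (Quotient.sound (y.component_rel (w, i)))
  · have h1 : x.component ≤ Setoid.comap Sum.inl (x.disjUnion y).component := by
      rw [component_le_iff]
      intro h
      exact (x.disjUnion y).component_rel (Sum.inl h.1, h.2)
    have h2 : y.component ≤ Setoid.comap Sum.inr (x.disjUnion y).component := by
      rw [component_le_iff]
      intro h
      exact (x.disjUnion y).component_rel (Sum.inr h.1, h.2)
    rintro (v | w) (v' | w') h <;> rw [Setoid.ker_def] at h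
    · simp only [Sum.map_inl, Sum.inl.injEq] at h
      exact h1 (Quotient.exact h)
    · simp at h
    · simp at h
    · simp only [Sum.map_inr, Sum.inr.injEq] at h
      exact h2 (Quotient.exact h)

/-- The components of a disjoint union. -/
noncomputable def disjUnionComponents (x : TraceMap p V) (y : TraceMap p W) :
    Quotient (x.disjUnion y).component ≃ Quotient x.component ⊕ Quotient y.component :=
  (Quotient.congrRight fun a b => by rw [disjUnion_component]).trans
    (Setoid.quotientKerEquivOfSurjective
      (Sum.map (Quotient.mk x.component) (Quotient.mk y.component))
      (Sum.map_surjective.2 ⟨Quotient.mk_surjective, Quotient.mk_surjective⟩))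

theorem disjUnionComponents_mk (x : TraceMap p V) (y : TraceMap p W) (v : V ⊕ W) :
    disjUnionComponents x y (Quotient.mk _ v) =
      Sum.map (Quotient.mk x.component) (Quotient.mk y.component) v := rfl

theorem numComponents_disjUnion [Finite V] [Finite W] (x : TraceMap p V) (y : TraceMap p W) :
    (x.disjUnion y).numComponents = x.numComponents + y.numComponents := by
  rw [numComponents, Nat.card_congr (disjUnionComponents x y), Nat.card_sum]
  rfl

theorem disjUnion_switch_inl (x : TraceMap p V) (y : TraceMap p W) (h k : V × Fin p) :
    (x.disjUnion y).switch (Sum.inl h.1, h.2) (Sum.inl k.1, k.2) =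
      (x.switch h k).disjUnion y := by
  have inj : Function.Injective fun a : V × Fin p => ((Sum.inl a.1, a.2) : (V ⊕ W) × Fin p) := by
    intro a b hab
    simp only [Prod.mk.injEq, Sum.inl.injEq] at hab
    exact Prod.ext hab.1 hab.2
  have key : ∀ a : V × Fin p, Equiv.swap ((Sum.inl h.1, h.2) : (V ⊕ W) × Fin p)
      (Sum.inl k.1, k.2) (Sum.inl a.1, a.2) =
        (Sum.inl (Equiv.swap h k a).1, (Equiv.swap h k a).2) := fun a =>
    (inj.map_swap h k a).symm
  ext1; funext a
  rcases a with ⟨v | w, i⟩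
  · rw [switch_α]
    refine (congrArg (fun c => Equiv.swap _ _ ((x.disjUnion y).α c)) (key (v, i))).trans ?_
    rw [disjUnion_α_inl, key]
    rfl
  · rw [switch_α]
    refine (congrArg (fun c => Equiv.swap _ _ ((x.disjUnion y).α c))
      (Equiv.swap_apply_of_ne_of_ne (by simp) (by simp))).trans ?_
    refine (congrArg (Equiv.swap _ _) (disjUnion_α_inr x y (w, i))).trans ?_
    rw [Equiv.swap_apply_of_ne_of_ne (by simp) (by simp)]
    rfl

theorem disjUnion_switch_inr (x : TraceMap p V) (y : TraceMap p W) (h k : W × Fin p) :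
    (x.disjUnion y).switch (Sum.inr h.1, h.2) (Sum.inr k.1, k.2) =
      x.disjUnion (y.switch h k) := by
  have inj : Function.Injective fun a : W × Fin p => ((Sum.inr a.1, a.2) : (V ⊕ W) × Fin p) := by
    intro a b hab
    simp only [Prod.mk.injEq, Sum.inr.injEq] at hab
    exact Prod.ext hab.1 hab.2
  have key : ∀ a : W × Fin p, Equiv.swap ((Sum.inr h.1, h.2) : (V ⊕ W) × Fin p)
      (Sum.inr k.1, k.2) (Sum.inr a.1, a.2) =
        (Sum.inr (Equiv.swap h k a).1, (Equiv.swap h k a).2) := fun a =>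
    (inj.map_swap h k a).symm
  ext1; funext a
  rcases a with ⟨v | w, i⟩
  · rw [switch_α]
    refine (congrArg (fun c => Equiv.swap _ _ ((x.disjUnion y).α c))
      (Equiv.swap_apply_of_ne_of_ne (by simp) (by simp))).trans ?_
    refine (congrArg (Equiv.swap _ _) (disjUnion_α_inl x y (v, i))).trans ?_
    rw [Equiv.swap_apply_of_ne_of_ne (by simp) (by simp)]
    rfl
  · rw [switch_α]
    refine (congrArg (fun c => Equiv.swap _ _ ((x.disjUnion y).α c)) (key (w, i))).trans ?_
    rw [disjUnion_α_inr, key]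
    rfl

theorem step_disjUnion_left [Finite V] [Finite W] {x' x : TraceMap p V} (y : TraceMap p W)
    (h : Step x' x) : Step (x'.disjUnion y) (x.disjUnion y) := by
  obtain ⟨h1, h2⟩ := h
  obtain ⟨h, k, rfl⟩ := (isSwitch_iff _ _).1 h1
  refine ⟨(isSwitch_iff _ _).2 ⟨_, _, (disjUnion_switch_inl x y h k).symm⟩, ?_⟩
  rw [numComponents_disjUnion, numComponents_disjUnion]
  omega

theorem step_disjUnion_right [Finite V] [Finite W] (x : TraceMap p V) {y' y : TraceMap p W}
    (h : Step y' y) : Step (x.disjUnion y') (x.disjUnion y) := by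
  obtain ⟨h1, h2⟩ := h
  obtain ⟨h, k, rfl⟩ := (isSwitch_iff _ _).1 h1
  refine ⟨(isSwitch_iff _ _).2 ⟨_, _, (disjUnion_switch_inr x y h k).symm⟩, ?_⟩
  rw [numComponents_disjUnion, numComponents_disjUnion]
  omega

theorem isLeft_eq_of_component_le {z : TraceMap p (V ⊕ W)} {x : TraceMap p V} {y : TraceMap p W}
    (h : z.component ≤ (x.disjUnion y).component) (a : (V ⊕ W) × Fin p) :
    (z.α a).1.isLeft = a.1.isLeft := by
  have := h (z.component_rel a)
  rw [disjUnion_component, Setoid.ker_def] at this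
  have := congrArg Sum.isLeft this
  simpa using this.symm

/-- A step refines the components, so no edge of `z` crosses between the two sides, whereas a switch
with one half-edge on each side creates a crossing edge. -/
theorem step_disjUnion [Finite V] [Finite W] (hp : Even p) {z : TraceMap p (V ⊕ W)}
    {x : TraceMap p V} {y : TraceMap p W} (hs : Step z (x.disjUnion y)) :
    (∃ x', Step x' x ∧ z = x'.disjUnion y) ∨ (∃ y', Step y' y ∧ z = x.disjUnion y') := by
  have hz := isLeft_eq_of_component_le (hs.component_le hp)
  obtain ⟨h1, h2⟩ := hs
  obtain ⟨h, k, rfl⟩ := (isSwitch_iff _ _).1 h1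
  rw [numComponents_disjUnion] at h2
  have mixed : ∀ (a : V × Fin p) (b : W × Fin p), ¬ ∀ c,
      (((x.disjUnion y).switch (Sum.inl a.1, a.2) (Sum.inr b.1, b.2)).α c).1.isLeft =
        c.1.isLeft := by
    intro a b H
    have := H (Sum.inl a.1, a.2)
    rw [switch_α_left, disjUnion_α_inr] at this
    · simp at this
    · rw [disjUnion_α_inl]; simp
  rcases h with ⟨v | v, i⟩ <;> rcases k with ⟨w | w, j⟩
  · left
    have e := disjUnion_switch_inl x y (v, i) (w, j)
    refine ⟨x.switch (v, i) (w, j), ⟨(isSwitch_iff _ _).2 ⟨_, _, rfl⟩, ?_⟩, e⟩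
    rw [e, numComponents_disjUnion] at h2
    omega
  · exact (mixed (v, i) (w, j) hz).elim
  · rw [switch_comm] at hz
    exact (mixed (w, j) (v, i) hz).elim
  · right
    have e := disjUnion_switch_inr x y (v, i) (w, j)
    refine ⟨y.switch (v, i) (w, j), ⟨(isSwitch_iff _ _).2 ⟨_, _, rfl⟩, ?_⟩, e⟩
    rw [e, numComponents_disjUnion] at h2
    omega

/-- The lower set of a disjoint union is the product of the lower sets. -/
theorem belowEq_disjUnion [Finite V] [Finite W] (hp : Even p) {z : TraceMap p (V ⊕ W)}
    {x : TraceMap p V} {y : TraceMap p W} :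
    BelowEq z (x.disjUnion y) ↔
      ∃ x' y', BelowEq x' x ∧ BelowEq y' y ∧ z = x'.disjUnion y' := by
  simp only [belowEq_iff]
  constructor
  · intro h
    induction h using Relation.ReflTransGen.head_induction_on with
    | refl => exact ⟨x, y, .refl, .refl, rfl⟩
    | head hs _ ih =>
      obtain ⟨x', y', hx, hy, rfl⟩ := ih
      rcases step_disjUnion hp hs with ⟨x'', hx', rfl⟩ | ⟨y'', hy', rfl⟩
      · exact ⟨x'', y', .head hx' hx, hy, rfl⟩
      · exact ⟨x', y'', hx, .head hy' hy, rfl⟩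
  · rintro ⟨x', y', hx, hy, rfl⟩
    have h1 := Relation.ReflTransGen.lift (p := Step) (fun a => a.disjUnion y')
      (fun _ _ h => step_disjUnion_left y' h) _ _ hx
    have h2 := Relation.ReflTransGen.lift (p := Step) (fun a => x.disjUnion a)
      (fun _ _ h => step_disjUnion_right x h) _ _ hy
    exact Relation.ReflTransGen.trans h1 h2

theorem lowerSum_disjUnion [Finite V] [Finite W] (hp : Even p) (g : TraceMap p (V ⊕ W) → ℝ)
    (x : TraceMap p V) (y : TraceMap p W) :
    lowerSum g (x.disjUnion y) =
      ∑ x' with BelowEq x' x, ∑ y' with BelowEq y' y, g (x'.disjUnion y') := by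
  rw [← Finset.sum_product', lowerSum]
  symm
  refine Finset.sum_bij (fun q _ => q.1.disjUnion q.2) ?_ ?_ ?_ fun _ _ => rfl
  · rintro ⟨x', y'⟩ h
    simp only [Finset.mem_product, Finset.mem_filter, Finset.mem_univ, true_and] at h ⊢
    exact (belowEq_disjUnion hp).2 ⟨x', y', h.1, h.2, rfl⟩
  · rintro ⟨x', y'⟩ _ ⟨x'', y''⟩ _ h
    have := disjUnion_injective h
    exact Prod.ext this.1 this.2
  · intro z hz
    obtain ⟨x', y', h1, h2, rfl⟩ := (belowEq_disjUnion hp).1 (Finset.mem_filter.1 hz).2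
    exact ⟨(x', y'), by simp [h1, h2], rfl⟩

theorem lowerSum_mul_disjUnion [Finite V] [Finite W] (hp : Even p) (F : TraceMap p (V ⊕ W) → ℝ)
    (f : TraceMap p V → ℝ) (g : TraceMap p W → ℝ)
    (h : ∀ x y, F (x.disjUnion y) = f x * g y) (x : TraceMap p V) (y : TraceMap p W) :
    lowerSum F (x.disjUnion y) = lowerSum f x * lowerSum g y := by
  rw [lowerSum_disjUnion hp, lowerSum, lowerSum, Finset.sum_mul_sum]
  exact Finset.sum_congr rfl fun _ _ => Finset.sum_congr rfl fun _ _ => h _ _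

theorem moebiusInverse_disjUnion [Finite V] [Finite W] (hp : Even p)
    (F : TraceMap p (V ⊕ W) → ℝ) (f : TraceMap p V → ℝ) (g : TraceMap p W → ℝ)
    (h : ∀ x y, F (x.disjUnion y) = f x * g y) (x : TraceMap p V) (y : TraceMap p W) :
    moebiusInverse F (x.disjUnion y) = moebiusInverse f x * moebiusInverse g y := by
  -- The candidate is the product on disjoint unions. Its value elsewhere is immaterial, since
  -- everything below a disjoint union is one.
  let G : TraceMap p (V ⊕ W) → ℝ := fun z =>
    if hz : ∃ q : TraceMap p V × TraceMap p W, z = q.1.disjUnion q.2 then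
      moebiusInverse f hz.choose.1 * moebiusInverse g hz.choose.2 else 0
  have hG : ∀ x y, G (x.disjUnion y) = moebiusInverse f x * moebiusInverse g y := by
    intro x y
    have hz : ∃ q : TraceMap p V × TraceMap p W, x.disjUnion y = q.1.disjUnion q.2 :=
      ⟨(x, y), rfl⟩
    have := disjUnion_injective hz.choose_spec
    simp only [G]
    rw [dif_pos hz, ← this.1, ← this.2]
  rw [← hG]
  refine moebiusInverse_unique_of_le F G _ fun z hz => ?_
  obtain ⟨x', y', -, -, rfl⟩ := (belowEq_disjUnion hp).1 hz
  rw [h, lowerSum_mul_disjUnion hp G _ _ hG, ← eq_lowerSum_moebiusInverse,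
    ← eq_lowerSum_moebiusInverse]

end disjUnion

end TraceMap

/-! ### Alternating cycles and a rank criterion for the order -/

namespace TraceMap

open Classical

variable {p : ℕ} {V B : Type}

/-- The real functions on the half-edges that are invariant under the involutions of both maps. -/
def jointInvariants (x y : TraceMap p V) : Submodule ℝ (V × Fin p → ℝ) where
  carrier := {f | ∀ h, f (x.α h) = f h ∧ f (y.α h) = f h}
  add_mem' := fun ha hb h => by
    simp only [Pi.add_apply, (ha h).1, (ha h).2, (hb h).1, (hb h).2, and_self]
  zero_mem' := fun _ => ⟨rfl, rfl⟩
  smul_mem' := fun r a ha h => by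
    simp only [Pi.smul_apply, (ha h).1, (ha h).2, and_self]

theorem mem_jointInvariants {x y : TraceMap p V} {f : V × Fin p → ℝ} :
    f ∈ jointInvariants x y ↔ ∀ h, f (x.α h) = f h ∧ f (y.α h) = f h := Iff.rfl

/-- The number of alternating cycles of the edges of `x` and of `y`. -/
noncomputable def jointRank (x y : TraceMap p V) : ℕ := Module.finrank ℝ (jointInvariants x y)

theorem jointRank_comm (x y : TraceMap p V) : jointRank x y = jointRank y x := by
  have : jointInvariants x y = jointInvariants y x := by
    ext f
    simp only [mem_jointInvariants, and_comm]
  rw [jointRank, this, jointRank]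

theorem finrank_le_finrank_inf_ker_add_one {E : Type*} [AddCommGroup E] [Module ℝ E]
    [Module.Finite ℝ E] (M : Submodule ℝ E) (L : E →ₗ[ℝ] ℝ) :
    Module.finrank ℝ M ≤ Module.finrank ℝ (M ⊓ LinearMap.ker L : Submodule ℝ E) + 1 := by
  have h1 := LinearMap.finrank_range_add_finrank_ker (L.domRestrict M)
  have h2 : Module.finrank ℝ (LinearMap.range (L.domRestrict M)) ≤ 1 := by
    simpa using Submodule.finrank_le (LinearMap.range (L.domRestrict M))
  have h3 : (LinearMap.ker (L.domRestrict M)).map M.subtype = M ⊓ LinearMap.ker L := by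
    ext v
    simp [Submodule.mem_map, and_comm]
  have h4 := Submodule.finrank_map_subtype_eq M (LinearMap.ker (L.domRestrict M))
  rw [h3] at h4
  omega

theorem comp_swap_eq {H : Type*} [DecidableEq H] {f : H → ℝ} {h k : H} (hf : f h = f k) (a : H) :
    f (Equiv.swap h k a) = f a := by
  rcases eq_or_ne a h with rfl | h1
  · rw [Equiv.swap_apply_left, hf]
  rcases eq_or_ne a k with rfl | h2
  · rw [Equiv.swap_apply_right, hf]
  rw [Equiv.swap_apply_of_ne_of_ne h1 h2]

/-- The difference of the values at two points. -/
def evalDiff {H : Type*} (h k : H) : (H → ℝ) →ₗ[ℝ] ℝ :=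
  LinearMap.proj (R := ℝ) (φ := fun _ => ℝ) h - LinearMap.proj (R := ℝ) (φ := fun _ => ℝ) k

theorem mem_ker_evalDiff {H : Type*} {h k : H} {f : H → ℝ} :
    f ∈ LinearMap.ker (evalDiff h k) ↔ f h = f k := by
  simp [evalDiff, sub_eq_zero]

theorem invariant_switch {h k : V × Fin p} {x : TraceMap p V} {f : V × Fin p → ℝ} (hf : f h = f k)
    (hx : ∀ a, f (x.α a) = f a) (a : V × Fin p) : f ((x.switch h k).α a) = f a := by
  rw [switch_α, comp_swap_eq hf, hx, comp_swap_eq hf]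

/-- A function with equal values at `h` and `k` does not see their transposition. Hence both spaces
share a subspace of codimension at most one in each, and a switch changes `jointRank` by at most
one. -/
theorem jointInvariants_switch_inf (x y : TraceMap p V) (h k : V × Fin p) :
    jointInvariants (x.switch h k) y ⊓ LinearMap.ker (evalDiff h k) =
      jointInvariants x y ⊓ LinearMap.ker (evalDiff h k) := by
  ext f
  simp only [Submodule.mem_inf, mem_jointInvariants, mem_ker_evalDiff, forall_and]
  refine and_congr_left fun hf => and_congr_left fun _ => ⟨fun H => ?_, invariant_switch hf⟩
  have := invariant_switch hf H
  simpa using this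

theorem jointRank_switch_le [Finite V] (x y : TraceMap p V) (h k : V × Fin p) :
    jointRank (x.switch h k) y ≤ jointRank x y + 1 := by
  have h1 := finrank_le_finrank_inf_ker_add_one (jointInvariants (x.switch h k) y) (evalDiff h k)
  rw [jointInvariants_switch_inf] at h1
  have h2 := Submodule.finrank_mono
    (inf_le_left : jointInvariants x y ⊓ LinearMap.ker (evalDiff h k) ≤ jointInvariants x y)
  simp only [jointRank]
  omega

/-- The indicator function of an edge. -/
noncomputable def edgeIndicator (y : TraceMap p V) (h a : V × Fin p) : ℝ :=
  if a = h ∨ a = y.α h then 1 else 0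

theorem edgeIndicator_α (y : TraceMap p V) (h a : V × Fin p) :
    edgeIndicator y h (y.α a) = edgeIndicator y h a := by
  have e1 : y.α a = h ↔ a = y.α h := by rw [y.α_eq_iff, eq_comm]
  have e2 : y.α a = y.α h ↔ a = h := y.α_injective.eq_iff
  simp only [edgeIndicator, e1, e2, or_comm]

/-- This is the corrective switch: it gives `x` the edge of `y` at `h`. -/
theorem switch_α_eq (x y : TraceMap p V) (h : V × Fin p) :
    (x.switch (y.α h) (x.α h)).α h = y.α h := by
  rw [switch_α, Equiv.swap_apply_of_ne_of_ne (y.no_fix h).symm (x.no_fix h).symm,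
    Equiv.swap_apply_right]

/-- The corrective switch splits off the common edge as an alternating cycle of its own. Old
invariants already agree at `y.α h` and `x.α h`; the indicator of the new common edge is an
invariant that does not. -/
theorem jointRank_switch_eq [Finite V] (x y : TraceMap p V) {h : V × Fin p}
    (hne : x.α h ≠ y.α h) :
    jointRank (x.switch (y.α h) (x.α h)) y = jointRank x y + 1 := by
  have h1 := jointRank_switch_le x y (y.α h) (x.α h)
  have h2 : jointInvariants x y < jointInvariants (x.switch (y.α h) (x.α h)) y := by
    have e : jointInvariants x y =
        jointInvariants (x.switch (y.α h) (x.α h)) y ⊓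
          LinearMap.ker (evalDiff (y.α h) (x.α h)) := by
      rw [jointInvariants_switch_inf, eq_comm, inf_eq_left]
      intro f hf
      rw [mem_ker_evalDiff, (hf h).1, (hf h).2]
    rw [e]
    refine lt_of_le_of_ne inf_le_left fun e' => ?_
    rw [inf_eq_left] at e'
    have : edgeIndicator y h ∈ jointInvariants (x.switch (y.α h) (x.α h)) y := by
      intro a
      refine ⟨?_, edgeIndicator_α y h a⟩
      have : edgeIndicator y h = edgeIndicator (x.switch (y.α h) (x.α h)) h := by
        funext b
        rw [edgeIndicator, edgeIndicator, switch_α_eq x y h]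
      rw [this, edgeIndicator_α]
    have := mem_ker_evalDiff.1 (e' this)
    simp [edgeIndicator, hne, x.no_fix h] at this
  have h3 := Submodule.finrank_lt_finrank_of_lt h2
  simp only [jointRank] at h1 ⊢
  omega

theorem jointInvariants_le_right (x y : TraceMap p V) :
    jointInvariants x y ≤ jointInvariants y y := fun _ hf h => ⟨(hf h).2, (hf h).2⟩

theorem jointRank_le_right [Finite V] (x y : TraceMap p V) : jointRank x y ≤ jointRank y y :=
  Submodule.finrank_mono (jointInvariants_le_right x y)

/-- If the maps differed, a corrective switch would push the rank above its maximum `jointRank y y`.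
-/
theorem eq_of_jointRank_le [Finite V] {x y : TraceMap p V} (h : jointRank y y ≤ jointRank x y) :
    x = y := by
  by_contra hxy
  have : ∃ k, x.α k ≠ y.α k := by
    by_contra! H
    exact hxy (TraceMap.ext (funext H))
  obtain ⟨k, hk⟩ := this
  have h1 := jointRank_switch_eq x y hk
  have h2 := jointRank_le_right (x.switch (y.α k) (x.α k)) y
  omega

/-- A switch conjugates the involution by a transposition, which preserves the number of edges. -/
theorem jointRank_self_switch (x : TraceMap p V) (h k : V × Fin p) :
    jointRank (x.switch h k) (x.switch h k) = jointRank x x := by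
  have key : ∀ x : TraceMap p V, ∀ f ∈ jointInvariants x x,
      (fun a => f (Equiv.swap h k a)) ∈ jointInvariants (x.switch h k) (x.switch h k) := by
    intro x f hf a
    simp only [switch_α, Equiv.swap_apply_self, and_self]
    exact (hf _).1
  have : (jointInvariants x x).map
      (LinearEquiv.funCongrLeft ℝ ℝ (Equiv.swap h k)).toLinearMap =
      jointInvariants (x.switch h k) (x.switch h k) := by
    ext f
    rw [Submodule.mem_map]
    constructor
    · rintro ⟨g, hg, rfl⟩
      exact key x g hg
    · intro hf
      have := key _ f hf
      rw [switch_switch] at this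
      refine ⟨_, this, ?_⟩
      funext a
      simp [LinearEquiv.funCongrLeft_apply, LinearMap.funLeft_apply]
  rw [jointRank, ← this, LinearEquiv.finrank_map_eq]
  rfl

/-- Along a chain from `y` up to `x`, each step removes one component and lowers the number of
cycles shared with `y` by at most one. -/
theorem BelowEq.jointRank_le [Finite V] {y x : TraceMap p V} (h : BelowEq y x) :
    jointRank y y + x.numComponents ≤ jointRank x y + y.numComponents := by
  rw [belowEq_iff] at h
  induction h with
  | refl => exact le_rfl
  | @tail x' x _ hs ih =>
    obtain ⟨h1, h2⟩ := hs
    obtain ⟨h, k, rfl⟩ := (isSwitch_iff _ _).1 h1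
    have := jointRank_switch_le x y h k
    omega

theorem component_eq_top_iff [Finite V] {x : TraceMap p V} :
    x.Connected ↔ x.component = ⊤ ∧ Nonempty V := by
  rw [Connected, numComponents, Nat.card_eq_one_iff_unique]
  constructor
  · rintro ⟨h1, ⟨q⟩⟩
    refine ⟨?_, ⟨q.out⟩⟩
    rw [Setoid.eq_top_iff]
    intro v w
    exact Quotient.exact (h1.elim (Quotient.mk _ v) (Quotient.mk _ w))
  · rintro ⟨h1, ⟨v⟩⟩
    refine ⟨⟨fun a b => ?_⟩, ⟨Quotient.mk _ v⟩⟩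
    induction a using Quotient.inductionOn
    induction b using Quotient.inductionOn
    exact Quotient.sound ((Setoid.eq_top_iff.1 h1) _ _)

/-- Converse to `BelowEq.jointRank_le`. Unless `y` is connected, some edge of `x` leaves a component
of `y`; giving `y` this edge merges two components and raises the rank by one, so the inequality
persists. Once `y` is connected, it forces `x = y`. -/
theorem belowEq_of_jointRank_le [Finite V] (hp : Even p) (x : TraceMap p V) (n : ℕ) :
    ∀ y : TraceMap p V, y.numComponents = n + 1 → x.component ⊔ y.component = ⊤ →
      jointRank y y + 1 ≤ jointRank x y + y.numComponents → BelowEq y x ∧ x.Connected := by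
  induction n with
  | zero =>
    intro y h1 _ h3
    have : x = y := eq_of_jointRank_le (by omega)
    subst this
    exact ⟨BelowEq.refl x, h1⟩
  | succ n ih =>
    intro y h1 h2 h3
    have : ∃ h, ¬ y.component h.1 (x.α h).1 := by
      by_contra! H
      rw [← component_le_iff, ← sup_eq_right, h2] at H
      have : Nonempty V := by
        by_contra hV
        rw [not_nonempty_iff] at hV
        have := numComponents_le y
        rw [Nat.card_of_isEmpty] at this
        omega
      have := component_eq_top_iff.2 ⟨H.symm, this⟩
      rw [Connected] at this
      omega
    obtain ⟨h, hh⟩ := this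
    have hne : y.α h ≠ x.α h := fun e => hh (e ▸ y.component_rel h)
    have hk : ¬ y.component (x.α h).1 (y.α h).1 := fun e =>
      hh (Setoid.trans' _ (y.component_rel h) (Setoid.symm' _ e))
    have e1 := numComponents_switch hp y hk
    have e2 := jointRank_switch_eq y x hne
    have e3 := jointRank_self_switch y (x.α h) (y.α h)
    rw [jointRank_comm, jointRank_comm y x] at e2
    obtain ⟨b1, b2⟩ := ih (y.switch (x.α h) (y.α h)) (by omega)
      (top_le_iff.1 (h2 ▸ sup_le_sup_left (le_switch_component hp y hk) _)) (by omega)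
    refine ⟨BelowEq.trans ?_ b1, b2⟩
    rw [belowEq_iff]
    exact Relation.ReflTransGen.single (step_switch hp y hk)

/-- The edges of `x` join the classes of vertices with labels in `S` into one. -/
def Linked (x : TraceMap p V) (c : V → B) (S : Finset B) : Prop :=
  ∀ P : B → Prop, (∀ h, P (c h.1) ↔ P (c (x.α h).1)) → ∀ i ∈ S, ∀ j ∈ S, P i → P j

/-- The functions of the label form a space of dimension `S.card` among the invariants of `y`, and
by linkage only constants among them are invariant under `x`. So the inequality defining `glued` is
an extremal condition. -/
theorem Linked.jointRank_add_card_le [Finite V] [Nonempty V] {x y : TraceMap p V} {c : V → B}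
    {S : Finset B} (hp : 0 < p) (hx : Linked x c S) (hc : ∀ h, c (y.α h).1 = c h.1)
    (hS : ∀ i, i ∈ S ↔ ∃ v, c v = i) : jointRank x y + S.card ≤ jointRank y y + 1 := by
  let c' : V × Fin p → S := fun h => ⟨c h.1, (hS _).2 ⟨h.1, rfl⟩⟩
  have hsurj : Function.Surjective c' := by
    rintro ⟨i, hi⟩
    obtain ⟨v, hv⟩ := (hS i).1 hi
    exact ⟨(v, ⟨0, hp⟩), Subtype.ext hv⟩
  let L := LinearMap.funLeft ℝ ℝ c'
  have hL : Module.finrank ℝ (LinearMap.range L) = S.card := by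
    rw [LinearMap.finrank_range_of_inj (LinearMap.funLeft_injective_of_surjective ℝ ℝ c' hsurj)]
    simp
  have h1 : LinearMap.range L ⊔ jointInvariants x y ≤ jointInvariants y y := by
    refine sup_le ?_ (jointInvariants_le_right x y)
    rintro _ ⟨f, rfl⟩ h
    have : c' (y.α h) = c' h := Subtype.ext (hc h)
    simp [L, LinearMap.funLeft_apply, this]
  have h2 : LinearMap.range L ⊓ jointInvariants x y ≤ Submodule.span ℝ {fun _ => (1 : ℝ)} := by
    rintro _ ⟨⟨f, rfl⟩, hf⟩
    obtain ⟨v⟩ := ‹Nonempty V›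
    let h0 : V × Fin p := (v, ⟨0, hp⟩)
    rw [Submodule.mem_span_singleton]
    refine ⟨f (c' h0), ?_⟩
    funext h
    have := hx (fun i => ∀ hi : i ∈ S, f ⟨i, hi⟩ = f (c' h0)) ?_ _ (c' h0).2 _ (c' h).2
      (fun _ => rfl) (c' h).2
    · simpa [L, LinearMap.funLeft_apply] using this.symm
    · intro k
      have e := (hf k).1
      simp only [L, LinearMap.funLeft_apply] at e
      constructor
      · intro H _
        exact e.trans (H (c' k).2)
      · intro H _
        exact e.symm.trans (H (c' (x.α k)).2)
  have h3 := Submodule.finrank_mono h1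
  have h4 := (Submodule.finrank_mono h2).trans (finrank_span_le_card _)
  have h5 := Submodule.finrank_sup_add_finrank_inf_eq (LinearMap.range L) (jointInvariants x y)
  simp only [Set.toFinset_singleton, Finset.card_singleton] at h4
  simp only [jointRank]
  omega

end TraceMap

/-! ### Tree-like gluings and their recursion -/

namespace TraceMap

open Classical

variable {p : ℕ} {V B : Type}

/-- The maps that agree with `y` away from `A` and are obtained by gluing the classes of vertices with
labels in `S` in a tree-like way. -/
noncomputable def glued [Finite V] (y : TraceMap p V) (c : V → B) (S : Finset B)
    (A : Finset (V × Fin p)) : Finset (TraceMap p V) :=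
  {x | (∀ h ∉ A, x.α h = y.α h) ∧ Linked x c S ∧ jointRank y y + 1 ≤ jointRank x y + S.card}

theorem mem_glued [Finite V] {x y : TraceMap p V} {c : V → B} {S : Finset B}
    {A : Finset (V × Fin p)} : x ∈ glued y c S A ↔
      (∀ h ∉ A, x.α h = y.α h) ∧ Linked x c S ∧ jointRank y y + 1 ≤ jointRank x y + S.card := by
  simp [glued]

theorem glued_of_card_eq_one [Finite V] {y : TraceMap p V} {c : V → B} {S : Finset B}
    {A : Finset (V × Fin p)} (hS : S.card = 1) : glued y c S A = {y} := by
  ext x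
  rw [mem_glued, Finset.mem_singleton]
  constructor
  · rintro ⟨_, _, h⟩
    exact eq_of_jointRank_le (by omega)
  · rintro rfl
    refine ⟨fun _ _ => rfl, ?_, by omega⟩
    intro P _ i hi j hj h
    rwa [Finset.card_le_one.1 hS.le j hj i hi]

theorem glued_empty [Finite V] {y : TraceMap p V} {c : V → B} {S : Finset B}
    (hc : ∀ h, c (y.α h).1 = c h.1) (hS : 1 < S.card) : glued y c S ∅ = ∅ := by
  rw [Finset.eq_empty_iff_forall_notMem]
  intro x hx
  rw [mem_glued] at hx
  obtain ⟨h1, h2, _⟩ := hx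
  have : x = y := TraceMap.ext (funext fun h => h1 h (by simp))
  subst this
  obtain ⟨i, hi, j, hj, hij⟩ := Finset.one_lt_card.1 hS
  exact hij.symm (h2 (fun k => k = i) (fun h => by rw [hc]) i hi j hj rfl)

/-- The label `j` is replaced by `i`. -/
noncomputable def mergeLabel (i j : B) (k : B) : B := if k = j then i else k

theorem mergeLabel_of_ne {i j k : B} (h : k ≠ j) : mergeLabel i j k = k := if_neg h

@[simp] theorem mergeLabel_self (i j : B) : mergeLabel i j j = i := if_pos rfl

/-- The edge of `x` from `ε` to `δ` already identifies their labels. After these are merged, the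
switch only exchanges half-edges of equal label and so does not affect linkage. -/
theorem linked_switch_iff {x : TraceMap p V} {c : V → B} {S : Finset B} {ε ε' δ : V × Fin p}
    (hx : x.α ε = δ) (hx' : (x.switch ε' δ).α ε = ε') (hε : c ε'.1 = c ε.1)
    (hδ : c δ.1 ≠ c ε.1) (h1 : c ε.1 ∈ S) :
    Linked (x.switch ε' δ) (fun v => mergeLabel (c ε.1) (c δ.1) (c v)) (S.erase (c δ.1)) ↔
      Linked x c S := by
  -- A predicate that does not separate the two merged labels is blind to the transposition.
  have key : ∀ P : B → Prop, (P (c ε.1) ↔ P (c δ.1)) → ∀ a : V × Fin p,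
      P (c (Equiv.swap ε' δ a).1) ↔ P (c a.1) := by
    intro P hP a
    rcases eq_or_ne a ε' with rfl | n1
    · rw [Equiv.swap_apply_left, ← hP, hε]
    rcases eq_or_ne a δ with rfl | n2
    · rw [Equiv.swap_apply_right, ← hP, hε]
    rw [Equiv.swap_apply_of_ne_of_ne n1 n2]
  have key' : ∀ (P : B → Prop) (x : TraceMap p V), (P (c ε.1) ↔ P (c δ.1)) →
      (∀ h, P (c h.1) ↔ P (c (x.α h).1)) →
      ∀ h, P (c h.1) ↔ P (c ((x.switch ε' δ).α h).1) := by
    intro P x hP H h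
    rw [switch_α, key P hP, ← H, key P hP]
  constructor
  · intro H P hP
    have e : P (c ε.1) ↔ P (c δ.1) := by rw [hP ε, hx]
    have e' : ∀ k, P (mergeLabel (c ε.1) (c δ.1) k) ↔ P k := by
      intro k
      by_cases hk : k = c δ.1
      · rw [hk, mergeLabel_self, e]
      · rw [mergeLabel_of_ne hk]
    have hmem : ∀ i ∈ S, mergeLabel (c ε.1) (c δ.1) i ∈ S.erase (c δ.1) := by
      intro i hi
      by_cases hk : i = c δ.1
      · rw [hk, mergeLabel_self]; exact Finset.mem_erase.2 ⟨hδ.symm, h1⟩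
      · rw [mergeLabel_of_ne hk]; exact Finset.mem_erase.2 ⟨hk, hi⟩
    have := H P (fun h => by rw [e', e', ← key' P x e hP h])
    intro i hi j hj hPi
    rw [← e']
    exact this _ (hmem i hi) _ (hmem j hj) ((e' i).2 hPi)
  · intro H P hP i hi j hj hPi
    rw [Finset.mem_erase] at hi hj
    have e : P (mergeLabel (c ε.1) (c δ.1) (c ε.1)) ↔ P (mergeLabel (c ε.1) (c δ.1) (c δ.1)) := by
      rw [mergeLabel_self, mergeLabel_of_ne hδ.symm]
    have := H (fun k => P (mergeLabel (c ε.1) (c δ.1) k)) ?_ i hi.2 j hj.2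
    · simpa only [mergeLabel_of_ne hi.1, mergeLabel_of_ne hj.1, hPi, true_implies] using this
    · have := key' (fun k => P (mergeLabel (c ε.1) (c δ.1) k)) (x.switch ε' δ) e hP
      simpa only [switch_switch] using this

section recursion

variable [Finite V] {y : TraceMap p V} {c : V → B} {S : Finset B} {A : Finset (V × Fin p)}
  {ε δ : V × Fin p}

theorem card_glued_fiber_self :
    {x ∈ glued y c S A | x.α ε = y.α ε} = glued y c S ((A.erase ε).erase (y.α ε)) := by
  ext x
  simp only [Finset.mem_filter, mem_glued]
  constructor
  · rintro ⟨⟨h1, h2⟩, h3⟩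
    refine ⟨fun h hh => ?_, h2⟩
    by_cases n1 : h = y.α ε
    · rw [n1, y.invol, ← h3, x.invol]
    by_cases n2 : h = ε
    · rw [n2, h3]
    exact h1 h fun h4 => hh (Finset.mem_erase.2 ⟨n1, Finset.mem_erase.2 ⟨n2, h4⟩⟩)
  · rintro ⟨h1, h2⟩
    refine ⟨⟨fun h hh => h1 h fun H => hh ?_, h2⟩, h1 ε (by simp)⟩
    exact Finset.mem_of_mem_erase (Finset.mem_of_mem_erase H)

/-- Restoring the edge of `y` at `ε` gains one alternating cycle, and merging the labels loses one
element of `S`, so the extremal condition is unchanged. The restored edge can then be removed from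
`A`. -/
theorem mem_glued_switch_iff (hA : ∀ h ∈ A, y.α h ∈ A)
    (hc : ∀ h, c (y.α h).1 = c h.1) (hS : ∀ i, i ∈ S ↔ ∃ v, c v = i) (hε : ε ∈ A) (hδ : δ ∈ A)
    (hne : c δ.1 ≠ c ε.1) {x : TraceMap p V} (hx : x.α ε = δ) :
    x.switch (y.α ε) δ ∈ glued y (fun v => mergeLabel (c ε.1) (c δ.1) (c v)) (S.erase (c δ.1))
      ((A.erase ε).erase (y.α ε)) ↔ x ∈ glued y c S A := by
  have hne' : x.α ε ≠ y.α ε := fun e => hne (by rw [← hx, e, hc])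
  have hx' : (x.switch (y.α ε) δ).α ε = y.α ε := by
    rw [← hx]; exact switch_α_eq x y ε
  have hr : jointRank (x.switch (y.α ε) δ) y = jointRank x y + 1 := by
    rw [← hx]; exact jointRank_switch_eq x y hne'
  have hδS : c δ.1 ∈ S := (hS _).2 ⟨_, rfl⟩
  have hcard := Finset.card_erase_add_one hδS
  rw [mem_glued, mem_glued, linked_switch_iff hx hx' (hc ε) hne ((hS _).2 ⟨_, rfl⟩)]
  refine and_congr ?_ (and_congr_right fun _ => by omega)
  have hA' : ∀ h, h ∉ A → y.α h ∉ A := fun h hh H => hh (by simpa [y.invol] using hA _ H)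
  constructor
  · intro H h hh
    have := H h (by simp [hh])
    have a1 : Equiv.swap (y.α ε) δ h = h := Equiv.swap_apply_of_ne_of_ne
      (by rintro rfl; exact hh (hA _ hε)) (by rintro rfl; exact hh hδ)
    have a2 : Equiv.swap (y.α ε) δ (y.α h) = y.α h := Equiv.swap_apply_of_ne_of_ne
      (fun e => hh (by rw [y.α_injective e]; exact hε)) (fun e => hA' h hh (e ▸ hδ))
    rwa [switch_α, Equiv.swap_apply_eq_iff, a1, a2] at this
  · intro H h hh
    by_cases n1 : h = y.α ε
    · rw [n1, y.invol, α_eq_iff, hx']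
    by_cases n2 : h = ε
    · rw [n2, hx']
    have hh' : h ∉ A := fun h4 => hh (Finset.mem_erase.2 ⟨n1, Finset.mem_erase.2 ⟨n2, h4⟩⟩)
    rw [switch_α, Equiv.swap_apply_of_ne_of_ne n1, H h hh', Equiv.swap_apply_of_ne_of_ne]
    · intro e; exact hh' (by rw [y.α_injective e]; exact hε)
    · intro e; exact hA' h hh' (e ▸ hδ)
    · rintro rfl; exact hh' hδ

theorem card_glued_fiber (hA : ∀ h ∈ A, y.α h ∈ A)
    (hc : ∀ h, c (y.α h).1 = c h.1) (hS : ∀ i, i ∈ S ↔ ∃ v, c v = i) (hε : ε ∈ A) (hδ : δ ∈ A)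
    (hne : c δ.1 ≠ c ε.1) :
    (glued y (fun v => mergeLabel (c ε.1) (c δ.1) (c v)) (S.erase (c δ.1))
      ((A.erase ε).erase (y.α ε))).card = ({x ∈ glued y c S A | x.α ε = δ}).card := by
  have n1 : ε ≠ y.α ε := (y.no_fix ε).symm
  have n2 : ε ≠ δ := by rintro rfl; exact hne rfl
  refine Finset.card_nbij' (fun x => x.switch (y.α ε) δ) (fun x => x.switch (y.α ε) δ) ?_ ?_
    (fun _ _ => switch_switch _ _ _) (fun _ _ => switch_switch _ _ _)
  · intro x hx
    have h1 : x.α ε = y.α ε := (mem_glued.1 hx).1 ε (by simp)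
    have h2 : (x.switch (y.α ε) δ).α ε = δ := by
      rw [switch_α, Equiv.swap_apply_of_ne_of_ne n1 n2, h1, Equiv.swap_apply_left]
    simp only [Finset.coe_filter, Set.mem_ofPred_eq]
    refine ⟨(mem_glued_switch_iff hA hc hS hε hδ hne h2).1 ?_, h2⟩
    rw [switch_switch]
    exact hx
  · intro x hx
    simp only [Finset.coe_filter, Set.mem_ofPred_eq] at hx
    exact (mem_glued_switch_iff hA hc hS hε hδ hne hx.2).2 hx.1

/-- The gluings are sorted by the partner `δ` of `ε`: the old partner, a half-edge with another
label (undone by a switch that merges the labels), or a different half-edge with the same label,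
which cannot occur. -/
theorem card_glued_rec (hp : 0 < p) (hA : ∀ h ∈ A, y.α h ∈ A)
    (hc : ∀ h, c (y.α h).1 = c h.1) (hS : ∀ i, i ∈ S ↔ ∃ v, c v = i) (hε : ε ∈ A) :
    (glued y c S A).card = (glued y c S ((A.erase ε).erase (y.α ε))).card +
      ∑ δ ∈ (A.erase ε).erase (y.α ε) with c δ.1 ≠ c ε.1,
        (glued y (fun v => mergeLabel (c ε.1) (c δ.1) (c v)) (S.erase (c δ.1))
          ((A.erase ε).erase (y.α ε))).card := by
  have hV : Nonempty V := ⟨ε.1⟩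
  have hmaps : ∀ x ∈ glued y c S A, x.α ε ∈ A := by
    intro x hx
    by_contra hcon
    have := (mem_glued.1 hx).1 _ hcon
    rw [x.invol, eq_comm, y.α_eq_iff] at this
    exact hcon (this ▸ hA ε hε)
  rw [Finset.card_eq_sum_card_fiberwise hmaps,
    ← Finset.add_sum_erase A _ (hA ε hε), card_glued_fiber_self]
  congr 1
  have hεA : ε ∈ A.erase (y.α ε) := Finset.mem_erase.2 ⟨(y.no_fix ε).symm, hε⟩
  rw [← Finset.add_sum_erase _ _ hεA, Finset.erase_right_comm]
  have h0 : {x ∈ glued y c S A | x.α ε = ε} = ∅ :=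
    Finset.filter_eq_empty_iff.2 fun x _ => x.no_fix ε
  rw [h0, Finset.card_empty, zero_add, Finset.sum_filter]
  refine Finset.sum_congr rfl fun δ hδ => ?_
  simp only [Finset.mem_erase] at hδ
  obtain ⟨n1, n2, hδ⟩ := hδ
  split_ifs with hne
  · exact (card_glued_fiber hA hc hS hε hδ hne).symm
  -- With equal labels the corrective switch would preserve linkage and still gain a cycle, against
  -- the bound of `Linked.jointRank_add_card_le`.
  · rw [Finset.card_eq_zero, Finset.filter_eq_empty_iff]
    intro x hx hxε
    push Not at hne
    have hne' : x.α ε ≠ y.α ε := hxε ▸ n1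
    obtain ⟨_, h2, h3⟩ := mem_glued.1 hx
    have h4 := jointRank_switch_eq x y hne'
    have h5 : Linked (x.switch (y.α ε) (x.α ε)) c S := by
      intro P hP
      refine h2 P ?_
      have key : ∀ a : V × Fin p, P (c (Equiv.swap (y.α ε) (x.α ε) a).1) ↔ P (c a.1) := by
        intro a
        rcases eq_or_ne a (y.α ε) with rfl | n1
        · rw [Equiv.swap_apply_left, hc, hxε, hne]
        rcases eq_or_ne a (x.α ε) with rfl | n2
        · rw [Equiv.swap_apply_right, hc, hxε, hne]
        rw [Equiv.swap_apply_of_ne_of_ne n1 n2]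
      intro h
      have := hP (Equiv.swap (y.α ε) (x.α ε) h)
      rw [switch_α, key, key, Equiv.swap_apply_self] at this
      exact this
    have := h5.jointRank_add_card_le hp hc hS
    omega

end recursion

end TraceMap

/-! ### The closed formula for the number of gluings -/

namespace TraceMap

open Classical

variable {p : ℕ} {V B : Type}

theorem card_filter_mergeLabel {H : Type*} (A : Finset H) (c : H → B) {i j k : B} (hij : i ≠ j)
    (hk : k ≠ j) : (A.filter fun a => mergeLabel i j (c a) = k).card =
      if k = i then (A.filter fun a => c a = i).card + (A.filter fun a => c a = j).card
      else (A.filter fun a => c a = k).card := by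
  split_ifs with h
  · subst h
    rw [← Finset.card_union_of_disjoint]
    · congr 1
      ext a
      rw [Finset.mem_union, Finset.mem_filter, Finset.mem_filter, Finset.mem_filter, mergeLabel]
      split_ifs with h' <;> simp [h', hij.symm]
    · rw [Finset.disjoint_filter]
      rintro a _ h1 h2
      exact hij (h1.symm.trans h2)
  · congr 1
    ext a
    rw [Finset.mem_filter, Finset.mem_filter, mergeLabel]
    split_ifs with h'
    · simp [h', Ne.symm h, hk.symm]
    · rfl

theorem sum_filter_label {H : Type*} (A : Finset H) (c : H → B) (S : Finset B)
    (hS : ∀ a ∈ A, c a ∈ S) (i : B) (T : B → ℕ) :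
    ∑ a ∈ A with c a ≠ i, T (c a) = ∑ j ∈ S.erase i, (A.filter fun a => c a = j).card * T j := by
  rw [← Finset.sum_fiberwise_of_maps_to (s := A.filter fun a => c a ≠ i) (t := S.erase i) (g := c)]
  · refine Finset.sum_congr rfl fun j hj => ?_
    have hj := Finset.ne_of_mem_erase hj
    rw [Finset.sum_congr rfl (g := fun _ => T j), Finset.sum_const, smul_eq_mul]
    · congr 2
      ext a
      simp only [Finset.mem_filter, and_assoc]
      refine and_congr_right fun _ => ⟨fun h => h.2, fun h => ⟨h ▸ hj, h⟩⟩
    · intro a ha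
      rw [(Finset.mem_filter.1 ha).2]
  · intro a ha
    rw [Finset.mem_filter] at ha
    exact Finset.mem_erase.2 ⟨ha.2, hS a ha.1⟩

/-- Arithmetic of the inductive step in `card_glued`: `N` is the new count, `g` and `s` are the
numbers of remaining half-edges in the chosen class and in the other classes, `P` is the product
over the other classes, and `D`, `D'` are consecutive falling factorials of `m`. -/
theorem glued_count_identity {m k N g P D D' s : ℕ} (hm : 0 < m) (hD : D' = (m - k) * D)
    (hD0 : m < k → D = 0) (hs : g + s = 2 * m)
    (h : 2 * m * N = g * P * D' + P * D * ((k + 1) * g + s)) :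
    2 * (m + 1) * N = (g + 2) * P * ((m + 1) * D) := by
  have h1 : m * (2 * N) = m * ((g + 2) * P * D) := by
    -- For `m < k` the subtraction is truncated, but then `D = 0` and everything vanishes.
    rcases lt_or_ge m k with hk | hk
    · have := hD0 hk
      subst this
      subst hD
      simp only [mul_zero, zero_mul, add_zero] at h ⊢
      linarith
    · obtain ⟨l, rfl⟩ := Nat.exists_eq_add_of_le hk
      rw [Nat.add_sub_cancel_left] at hD
      subst hD
      zify at *
      have : (s : ℤ) = 2 * (k + l) - g := by linarith
      rw [this] at h
      linear_combination h
  have h2 := Nat.eq_of_mul_eq_mul_left hm h1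
  calc 2 * (m + 1) * N = (m + 1) * (2 * N) := by ring
    _ = _ := by rw [h2]; ring

/-- Induction on the number `m` of edges of `y` in `A`, through `card_glued_rec`. The factor `2 * m`
avoids division. The formula depends only on class sizes, so it applies again after two classes are
merged. -/
theorem card_glued [Finite V] [Nonempty V] (hp : 0 < p) (y : TraceMap p V) (m : ℕ) :
    ∀ (c : V → B) (S : Finset B) (A : Finset (V × Fin p)), A.card = 2 * m →
      (∀ h ∈ A, y.α h ∈ A) → (∀ h, c (y.α h).1 = c h.1) → (∀ i, i ∈ S ↔ ∃ v, c v = i) →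
      2 * m * (glued y c S A).card =
        (∏ i ∈ S, (A.filter fun a => c a.1 = i).card) * m.descFactorial (S.card - 1) := by
  induction m with
  | zero =>
    intro c S A hcard _ _ hS
    have hA : A = ∅ := Finset.card_eq_zero.1 (by simpa using hcard)
    obtain ⟨v⟩ := ‹Nonempty V›
    rw [Finset.prod_eq_zero ((hS (c v)).2 ⟨v, rfl⟩) (by simp [hA])]
    simp
  | succ m ih =>
    intro c S A hcard hA hc hS
    have hAne : A.Nonempty := Finset.card_pos.1 (by omega)
    obtain ⟨ε, hε⟩ := hAne
    set i := c ε.1 with hi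
    have hiS : i ∈ S := (hS _).2 ⟨_, rfl⟩
    have hSpos : 0 < S.card := Finset.card_pos.2 ⟨i, hiS⟩
    rcases Nat.lt_or_ge 1 S.card with h1 | h1
    swap
    · have hS1 : S.card = 1 := by omega
      have hSi : S = {i} := by
        obtain ⟨j, hj⟩ := Finset.card_eq_one.1 hS1
        rw [hj, Finset.mem_singleton] at hiS
        rw [hj, hiS]
      rw [glued_of_card_eq_one hS1, hS1, hSi]
      have : (A.filter fun a => c a.1 = i) = A := by
        refine Finset.filter_true_of_mem fun a _ => ?_
        rw [← Finset.mem_singleton, ← hSi]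
        exact (hS _).2 ⟨_, rfl⟩
      simp [this, hcard]
    obtain ⟨k, hk⟩ := Nat.exists_eq_add_of_le' (Nat.succ_le_iff.2 h1)
    set A' := (A.erase ε).erase (y.α ε) with hA'
    have hε' : y.α ε ∈ A.erase ε := Finset.mem_erase.2 ⟨y.no_fix ε, hA ε hε⟩
    have hcard' : A'.card = 2 * m := by
      have e1 := Finset.card_erase_add_one hε'
      have e2 := Finset.card_erase_add_one hε
      rw [← hA'] at e1
      omega
    have hAA : ∀ h ∈ A', y.α h ∈ A' := by
      intro h hh
      simp only [A', Finset.mem_erase] at hh ⊢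
      refine ⟨fun e => hh.2.1 (y.α_injective e), fun e => hh.1 ?_, hA _ hh.2.2⟩
      rw [← e, y.invol]
    set g : B → ℕ := fun j => (A'.filter fun a => c a.1 = j).card with hg
    have hfi : (A.filter fun a => c a.1 = i).card = g i + 2 := by
      have e : (A.filter fun a => c a.1 = i) =
          insert ε (insert (y.α ε) (A'.filter fun a => c a.1 = i)) := by
        ext a
        simp only [A', Finset.mem_filter, Finset.mem_insert, Finset.mem_erase]
        constructor
        · intro H
          by_cases n1 : a = ε
          · exact Or.inl n1
          by_cases n2 : a = y.α ε
          · exact Or.inr (Or.inl n2)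
          exact Or.inr (Or.inr ⟨⟨n2, n1, H.1⟩, H.2⟩)
        · rintro (rfl | rfl | H)
          · exact ⟨hε, rfl⟩
          · exact ⟨hA _ hε, hc _⟩
          · exact ⟨H.1.2.2, H.2⟩
      rw [e, Finset.card_insert_of_notMem, Finset.card_insert_of_notMem]
      · simp [A']
      · simp [A', (y.no_fix ε).symm]
    have hfj : ∀ j ∈ S.erase i, (A.filter fun a => c a.1 = j).card = g j := by
      intro j hj
      have hj := Finset.ne_of_mem_erase hj
      simp only [hg]
      congr 1
      ext a
      simp only [A', Finset.mem_filter, Finset.mem_erase]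
      refine ⟨fun H => ⟨⟨?_, ?_, H.1⟩, H.2⟩, fun H => ⟨H.1.2.2, H.2⟩⟩
      · rintro rfl; exact hj (by rw [← H.2, hc])
      · rintro rfl; exact hj H.2.symm
    set P := ∏ j ∈ S.erase i, g j with hP
    have hprod : (∏ j ∈ S, (A.filter fun a => c a.1 = j).card) = (g i + 2) * P := by
      rw [← Finset.mul_prod_erase _ _ hiS, hfi, Finset.prod_congr rfl hfj]
    have hSe : (S.erase i).card = k + 1 := by
      have := Finset.card_erase_add_one hiS
      omega
    rw [hprod, show S.card - 1 = k + 1 by omega, Nat.succ_descFactorial_succ]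
    -- For a single edge the induction hypothesis reads `0 = 0`, so the count is made directly: no
    -- edge is left to link another class.
    rcases Nat.eq_zero_or_pos m with rfl | hm
    · have hA0 : A' = ∅ := Finset.card_eq_zero.1 (by simpa using hcard')
      have hP0 : P = 0 := by
        have : (S.erase i).Nonempty := Finset.card_pos.1 (by omega)
        obtain ⟨j, hj⟩ := this
        exact Finset.prod_eq_zero hj (by simp [hg, hA0])
      rw [card_glued_rec hp hA hc hS hε, ← hA', hA0, glued_empty hc h1, hP0]
      simp
    have hsum : ∑ j ∈ S, g j = 2 * m := by
      rw [← hcard', Finset.card_eq_sum_card_fiberwise (f := fun a => c a.1) (t := S)]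
      intro a _
      exact (hS _).2 ⟨_, rfl⟩
    rw [← Finset.add_sum_erase _ _ hiS] at hsum
    refine glued_count_identity (D' := m.descFactorial (k + 1)) hm (Nat.descFactorial_succ _ _)
      (fun h => Nat.descFactorial_of_lt h) hsum ?_
    rw [card_glued_rec hp hA hc hS hε, ← hA', mul_add, ih c S A' hcard' hAA hc hS,
      show S.card - 1 = k + 1 by omega, ← Finset.mul_prod_erase S _ hiS]
    congr 1
    have hδ : ∀ j ∈ S, j ≠ i →
        2 * m * (glued y (fun v => mergeLabel i j (c v)) (S.erase j) A').card =
          (g i + g j) * (∏ l ∈ (S.erase i).erase j, g l) * m.descFactorial k := by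
      intro j hj hji
      have hiS' : i ∈ S.erase j := Finset.mem_erase.2 ⟨hji.symm, hiS⟩
      have e : (S.erase j).card - 1 = k := by
        have := Finset.card_erase_add_one hj
        omega
      rw [ih (fun v => mergeLabel i j (c v)) (S.erase j) A' hcard' hAA (fun h => by rw [hc]), e,
        ← Finset.mul_prod_erase _ _ hiS', card_filter_mergeLabel A' (fun a => c a.1) hji.symm hji.symm,
        if_pos rfl, Finset.erase_right_comm]
      · congr 2
        refine Finset.prod_congr rfl fun l hl => ?_
        simp only [Finset.mem_erase] at hl
        rw [card_filter_mergeLabel A' (fun a => c a.1) hji.symm hl.1, if_neg hl.2.1]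
      · intro l
        rw [Finset.mem_erase, hS]
        constructor
        · rintro ⟨hl, v, rfl⟩
          exact ⟨v, mergeLabel_of_ne hl⟩
        · rintro ⟨v, rfl⟩
          by_cases hv : c v = j
          · rw [hv, mergeLabel_self]; exact ⟨hji.symm, (hS _).1 hiS⟩
          · rw [mergeLabel_of_ne hv]; exact ⟨hv, v, rfl⟩
    have e1 := sum_filter_label A' (fun a => c a.1) S (fun a _ => (hS _).2 ⟨_, rfl⟩) i
      (fun j => 2 * m * (glued y (fun v => mergeLabel i j (c v)) (S.erase j) A').card)
    rw [Finset.mul_sum, e1]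
    -- The `g j` choices of `δ` restore the factor that merging removed from the product, leaving `P
    -- * (g i + g j)`, which is then summed over `j`.
    calc _ = ∑ j ∈ S.erase i, P * m.descFactorial k * (g i + g j) := by
          refine Finset.sum_congr rfl fun j hj => ?_
          rw [hδ j (Finset.mem_of_mem_erase hj) (Finset.ne_of_mem_erase hj), hP,
            ← Finset.mul_prod_erase _ _ hj]
          ring
      _ = _ := by
          rw [← Finset.mul_sum, Finset.sum_add_distrib, Finset.sum_const, hSe, smul_eq_mul]

/-- The number of connected maps above `y` in the non-crossing poset. -/
theorem card_connected_above [Finite V] [Nonempty V] (hp : Even p) (hp0 : 0 < p)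
    (y : TraceMap p V) :
    p * Nat.card V * (Finset.univ.filter fun x : TraceMap p V => x.Connected ∧ BelowEq y x).card =
      (∏ᶠ q : Quotient y.component, p * Nat.card {v // Quotient.mk y.component v = q}) *
        (p / 2 * Nat.card V).descFactorial (y.numComponents - 1) := by
  have := Fintype.ofFinite V
  obtain ⟨q, rfl⟩ := hp
  have hq : (q + q) / 2 = q := by omega
  -- All half-edges are active, and a vertex is labelled by its component in `y`.
  have h1 := card_glued hp0 y (q * Nat.card V) (Quotient.mk y.component) Finset.univ Finset.univ
    (by simp; ring) (fun _ _ => Finset.mem_univ _)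
    (fun h => Quotient.sound (Setoid.symm' _ (y.component_rel h)))
    (fun i => ⟨fun _ => Quotient.mk_surjective i, fun _ => Finset.mem_univ _⟩)
  have hcomp : (Finset.univ : Finset (Quotient y.component)).card = y.numComponents := by
    rw [numComponents, Nat.card_eq_fintype_card, Finset.card_univ]
  have hset : glued y (Quotient.mk y.component) Finset.univ Finset.univ =
      Finset.univ.filter fun x : TraceMap (q + q) V => x.Connected ∧ BelowEq y x := by
    ext x
    rw [mem_glued, hcomp, Finset.mem_filter]
    simp only [Finset.mem_univ, not_true_eq_false, false_implies, implies_true, true_and]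
    constructor
    · rintro ⟨h2, h3⟩
      have hpos : 0 < y.numComponents := by
        obtain ⟨v⟩ := ‹Nonempty V›
        have : Nonempty (Quotient y.component) := ⟨Quotient.mk _ v⟩
        exact Nat.card_pos
      refine (belowEq_of_jointRank_le ⟨q, rfl⟩ x (y.numComponents - 1) y (by omega) ?_ h3).symm
      rw [Setoid.eq_top_iff]
      intro v w
      have hl : ∀ a b, y.component a b → ((x.component ⊔ y.component) v a ↔
          (x.component ⊔ y.component) v b) := by
        intro a b hab
        have hab : (x.component ⊔ y.component) a b := (le_sup_right : y.component ≤ _) hab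
        exact ⟨fun H => Setoid.trans' _ H hab, fun H => Setoid.trans' _ H (Setoid.symm' _ hab)⟩
      -- Linkage is tested on the predicate of being joined to `v` by edges of `x` and `y`.
      have := h2 (Quotient.lift (fun a => (x.component ⊔ y.component) v a)
        fun a b hab => propext (hl a b hab)) ?_ (Quotient.mk _ v) (Finset.mem_univ _)
          (Quotient.mk _ w) (Finset.mem_univ _)
      · exact this (Setoid.refl' _ v)
      · intro h
        have hab : (x.component ⊔ y.component) h.1 (x.α h).1 :=
          (le_sup_left : x.component ≤ _) (x.component_rel h)
        exact ⟨fun H => Setoid.trans' _ H hab, fun H => Setoid.trans' _ H (Setoid.symm' _ hab)⟩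
    · rintro ⟨h2, h3⟩
      have h4 := h3.jointRank_le
      rw [h2] at h4
      refine ⟨?_, h4⟩
      intro P hP i _ j _ hi
      have hle : x.component ≤ Setoid.ker fun v => P (Quotient.mk y.component v) := by
        rw [component_le_iff]
        exact fun h => propext (hP h)
      rw [(component_eq_top_iff.1 h2).1] at hle
      induction i using Quotient.inductionOn with | _ v
      induction j using Quotient.inductionOn with | _ w
      have e : P (Quotient.mk y.component v) = P (Quotient.mk y.component w) :=
        hle (Setoid.top_def ▸ trivial : (⊤ : Setoid V) v w)
      exact e ▸ hi
  rw [hset, hcomp] at h1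
  rw [hq, finprod_eq_prod_of_fintype]
  rw [show (q + q) * Nat.card V = 2 * (q * Nat.card V) by ring, h1]
  congr 1
  refine Finset.prod_congr rfl fun i _ => ?_
  calc _ = ((Finset.univ.filter fun v => Quotient.mk y.component v = i) ×ˢ
        (Finset.univ : Finset (Fin (q + q)))).card := by
        congr 1
        ext a
        simp
    _ = _ := by
        rw [Finset.card_product, Finset.card_univ, Fintype.card_fin, mul_comm,
          Nat.card_eq_fintype_card, Fintype.card_subtype]

end TraceMap

/-! ### The relabelling group acting on rooted maps -/

namespace TraceMap

open Classical

variable {p : ℕ} {V W X : Type}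

section group

variable [NeZero p]

theorem halfEdgeEquiv_trans (e : V ≃ W) (s : V → Fin p) (e' : W ≃ X) (s' : W → Fin p) :
    (halfEdgeEquiv e s).trans (halfEdgeEquiv e' s') =
      halfEdgeEquiv (e.trans e') fun v => s v + s' (e v) := by
  ext h <;> simp [halfEdgeEquiv, add_assoc]

theorem halfEdgeEquiv_symm (e : V ≃ W) (s : V → Fin p) :
    (halfEdgeEquiv e s).symm = halfEdgeEquiv e.symm fun w => -s (e.symm w) := by
  ext h <;> simp [halfEdgeEquiv, sub_eq_add_neg]

theorem eq_relabel_iff (e : V ≃ W) (s : V → Fin p) (x : TraceMap p V) (y : TraceMap p W) :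
    y = relabel e s x ↔ ∀ h, y.α (halfEdgeEquiv e s h) = halfEdgeEquiv e s (x.α h) := by
  constructor
  · rintro rfl h
    exact relabel_α e s x h
  · intro H
    ext1; funext k
    obtain ⟨h, rfl⟩ := (halfEdgeEquiv e s).surjective k
    rw [H, relabel_α]

theorem relabel_relabel (e : V ≃ W) (s : V → Fin p) (e' : W ≃ X) (s' : W → Fin p)
    (x : TraceMap p V) : relabel e' s' (relabel e s x) =
      relabel (e.trans e') (fun v => s v + s' (e v)) x := by
  rw [eq_relabel_iff]
  intro h
  rw [← halfEdgeEquiv_trans]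
  simp only [Equiv.trans_apply, relabel_α]

theorem relabel_symm (e : V ≃ W) (s : V → Fin p) (x : TraceMap p V) :
    relabel e.symm (fun w => -s (e.symm w)) (relabel e s x) = x := by
  symm
  rw [eq_relabel_iff]
  intro k
  obtain ⟨h, rfl⟩ := (halfEdgeEquiv e s).surjective k
  rw [← halfEdgeEquiv_symm, relabel_α, Equiv.symm_apply_apply, Equiv.symm_apply_apply]

/-- The vertices where the two relabellings agree, rotation included, are closed under following
edges of `x`; connectedness spreads agreement from the root. -/
theorem relabel_rigid [Finite V] {x : TraceMap p V} (hx : x.Connected) (r : V × Fin p)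
    {e e' : V ≃ W} {s s' : V → Fin p} (h : relabel e s x = relabel e' s' x)
    (hr : halfEdgeEquiv e s r = halfEdgeEquiv e' s' r) : e = e' ∧ s = s' := by
  have good : ∀ a, halfEdgeEquiv e s a = halfEdgeEquiv e' s' a ↔
      (e a.1 = e' a.1 ∧ s a.1 = s' a.1) := by
    intro a
    simp [halfEdgeEquiv]
  have key : ∀ a, halfEdgeEquiv e s a = halfEdgeEquiv e' s' a →
      halfEdgeEquiv e s (x.α a) = halfEdgeEquiv e' s' (x.α a) := by
    intro a ha
    rw [← relabel_α, ← relabel_α, h, ha]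
  have hle : x.component ≤ Setoid.ker fun v => (e v = e' v ∧ s v = s' v) := by
    rw [component_le_iff]
    intro a
    refine propext ⟨fun H => (good _).1 (key _ ((good _).2 H)), fun H => ?_⟩
    have := key _ ((good _).2 H)
    rw [x.invol] at this
    exact (good _).1 this
  rw [(component_eq_top_iff.1 hx).1] at hle
  have all : ∀ v, e v = e' v ∧ s v = s' v := by
    intro v
    have : (e r.1 = e' r.1 ∧ s r.1 = s' r.1) = (e v = e' v ∧ s v = s' v) :=
      hle (Setoid.top_def ▸ trivial : (⊤ : Setoid V) r.1 v)
    exact this ▸ (good r).1 hr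
  exact ⟨Equiv.ext fun v => (all v).1, funext fun v => (all v).2⟩

theorem connected_relabel {x : TraceMap p V} (e : V ≃ W) (s : V → Fin p) :
    (relabel e s x).Connected ↔ x.Connected := by
  rw [Connected, Connected, numComponents_relabel]

end group

end TraceMap

namespace RootedMap

open Classical TraceMap

variable {p n : ℕ}

/-- Rooted maps as pairs of a connected map and a half-edge. -/
def equivProd : RootedMap p n ≃ {x : TraceMap p (Fin n) // x.Connected} × (Fin n × Fin p) where
  toFun X := (⟨X.map, X.connected⟩, X.root)
  invFun Y := ⟨Y.1.1, Y.2, Y.1.2⟩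
  left_inv _ := rfl
  right_inv _ := rfl

noncomputable instance : Fintype (RootedMap p n) := Fintype.ofEquiv _ equivProd.symm

variable [NeZero p]

/-- The rooted map with relabelled half-edges. -/
def relabel (g : Equiv.Perm (Fin n) × (Fin n → Fin p)) (X : RootedMap p n) : RootedMap p n where
  map := TraceMap.relabel g.1 g.2 X.map
  root := halfEdgeEquiv g.1 g.2 X.root
  connected := (connected_relabel _ _).2 X.connected

theorem iso_iff (X Y : RootedMap p n) :
    (∃ e : X.map.Iso Y.map, e.onHalfEdge X.root = Y.root) ↔ ∃ g, relabel g X = Y := by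
  constructor
  · rintro ⟨e, he⟩
    refine ⟨(e.vert, e.shift), ?_⟩
    cases Y
    simp only [relabel, RootedMap.mk.injEq]
    exact ⟨e.eq_relabel.symm, he⟩
  · rintro ⟨g, rfl⟩
    exact ⟨relabelIso g.1 g.2 X.map, rfl⟩

theorem relabel_injective (X : RootedMap p n) : Function.Injective fun g => relabel g X := by
  rintro ⟨e, s⟩ ⟨e', s'⟩ h
  have h1 := congrArg RootedMap.map h
  have h2 := congrArg RootedMap.root h
  exact Prod.ext_iff.2 (relabel_rigid X.connected X.root h1 h2)

theorem equivalence : Equivalence fun X Y : RootedMap p n => ∃ g, relabel g X = Y where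
  refl X := ⟨(1, 0), by
    obtain ⟨x, r, hx⟩ := X
    have h1 : TraceMap.relabel (1 : Equiv.Perm (Fin n)) 0 x = x := by
      symm
      rw [eq_relabel_iff]
      intro h
      simp [halfEdgeEquiv]
    have h2 : halfEdgeEquiv (1 : Equiv.Perm (Fin n)) 0 r = r := by simp [halfEdgeEquiv]
    simp only [relabel, h1, h2]⟩
  symm := by
    rintro X _ ⟨g, rfl⟩
    obtain ⟨x, r, hx⟩ := X
    refine ⟨(g.1.symm, fun w => -g.2 (g.1.symm w)), ?_⟩
    simp only [relabel, TraceMap.relabel_symm, ← halfEdgeEquiv_symm, Equiv.symm_apply_apply]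
  trans := by
    rintro X _ _ ⟨g, rfl⟩ ⟨g', rfl⟩
    refine ⟨(g.1.trans g'.1, fun v => g.2 v + g'.2 (g.1 v)), ?_⟩
    simp only [relabel, TraceMap.relabel_relabel, ← halfEdgeEquiv_trans, Equiv.trans_apply]

/-- The class of a rooted map. -/
def toClass (X : RootedMap p n) : RootedClass p n := Quot.mk _ X

theorem toClass_eq_iff (X Y : RootedMap p n) :
    X.toClass = Y.toClass ↔ ∃ g, relabel g X = Y := by
  have hr : (fun x y : RootedMap p n => ∃ e : x.map.Iso y.map, e.onHalfEdge x.root = y.root) =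
      fun X Y => ∃ g, relabel g X = Y := by
    funext X Y
    exact propext (iso_iff X Y)
  exact Quot.eq.trans (by rw [hr, equivalence.eqvGen_iff])

instance : Finite (RootedClass p n) := inferInstanceAs (Finite (Quot _))

/-- By rigidity, the group of permutations and rotations, of order `n! p ^ n`, acts freely on rooted
connected maps, and a class is one orbit. -/
theorem card_class (b : RootedClass p n) :
    (Finset.univ.filter fun X : RootedMap p n => X.toClass = b).card =
      n.factorial * p ^ n := by
  obtain ⟨X, rfl⟩ := Quot.exists_rep b
  change (Finset.univ.filter fun Y : RootedMap p n => Y.toClass = X.toClass).card = _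
  have : (Finset.univ.filter fun Y : RootedMap p n => Y.toClass = X.toClass) =
      Finset.univ.image fun g => relabel g X := by
    ext Y
    simp only [Finset.mem_filter, Finset.mem_univ, true_and, Finset.mem_image]
    rw [eq_comm, toClass_eq_iff]
  rw [this, Finset.card_image_of_injective _ (relabel_injective X), Finset.card_univ,
    Fintype.card_prod, Fintype.card_perm, Fintype.card_fun, Fintype.card_fin, Fintype.card_fin]

end RootedMap

/-! ### Moments as sums over labelled maps -/

namespace TensorDistribution

open Classical TraceMap

variable {p : ℕ} [NeZero p]

/-- Labelled rooted maps are summed in two ways: by class, and by underlying map with its `p * n`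
roots. -/
theorem factorial_mul_moment (a : TensorDistribution p Unit) {n : ℕ} (hn : n ≠ 0) :
    ((n.factorial : ℝ) * p ^ n) * a.moment n =
      p * n * ∑ x : TraceMap p (Fin n) with x.Connected, a.val x fun _ => () := by
  have := Fintype.ofFinite (RootedClass p n)
  have h1 : ∑ X : RootedMap p n, a.val X.map (fun _ => ()) =
      ((n.factorial : ℝ) * p ^ n) * a.moment n := by
    rw [moment, if_neg hn, finsum_eq_sum_of_fintype, Finset.mul_sum,
      ← Finset.sum_fiberwise (g := RootedMap.toClass)]
    refine Finset.sum_congr rfl fun b _ => ?_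
    rw [Finset.sum_congr rfl (g := fun _ => a.evalClass b), Finset.sum_const, RootedMap.card_class]
    · simp
    · intro X hX
      rw [← (Finset.mem_filter.1 hX).2]
      rfl
  rw [← h1, ← Equiv.sum_comp RootedMap.equivProd.symm, Fintype.sum_prod_type]
  simp only [RootedMap.equivProd, Equiv.coe_fn_symm_mk, Finset.sum_const, Finset.card_univ,
    Fintype.card_prod, Fintype.card_fin, nsmul_eq_mul]
  rw [← Finset.mul_sum, ← Finset.sum_subtype_eq_sum_filter]
  push_cast
  rw [mul_comm (p : ℝ)]
  congr 1
  exact Finset.sum_congr (by ext; simp) fun _ _ => rfl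

end TensorDistribution

/-! ### Distributions built from cumulants and component weights -/

namespace TraceMap

open Classical

variable {p : ℕ} {V W : Type}

theorem Iso.component_iff [NeZero p] {x : TraceMap p V} {y : TraceMap p W} (e : x.Iso y) (v w : V) :
    y.component (e.vert v) (e.vert w) ↔ x.component v w := by
  have := relabel_component e.vert e.shift x v w
  rwa [← e.eq_relabel] at this

theorem lowerSum_eq_of_isEmpty [Finite V] [IsEmpty V] (g : TraceMap p V → ℝ) (x : TraceMap p V) :
    lowerSum g x = g x := by
  have h : ∀ y : TraceMap p V, y = x := fun y => TraceMap.ext (funext fun h => isEmptyElim h.1)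
  rw [lowerSum, Finset.sum_eq_single x (fun y _ hy => (hy (h y)).elim)]
  intro hx
  exact (hx (by simp [BelowEq.refl])).elim

end TraceMap

namespace TensorDistribution

open Classical TraceMap

variable {p : ℕ} {ι : Type}

/-- The product of two distributions. -/
noncomputable def mul (Φ Ψ : TensorDistribution p ι) : TensorDistribution p ι where
  val x c := Φ.val x c * Ψ.val x c
  iso_inv x y e c := by rw [Φ.iso_inv x y e, Ψ.iso_inv x y e]
  val_empty x c := by rw [Φ.val_empty, Ψ.val_empty, mul_one]
  val_disjUnion x y c d := by rw [Φ.val_disjUnion, Ψ.val_disjUnion]; ring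

/-- The free cumulants of a distribution, as a distribution. -/
noncomputable def cumulants [NeZero p] (hp : Even p) (Φ : TensorDistribution p ι) :
    TensorDistribution p ι where
  val x c := Φ.freeCumulant x c
  iso_inv {V W} _ _ x y e c := by
    have h := e.eq_relabel
    obtain ⟨e, s, hes⟩ := e
    dsimp only at h ⊢
    subst h
    rw [freeCumulant, freeCumulant, moebiusInverse_relabel]
    congr 1
    funext z
    exact Φ.iso_inv z _ (relabelIso e s z) c
  val_empty x c := by
    rw [freeCumulant, ← lowerSum_eq_of_isEmpty (moebiusInverse _) x,
      ← eq_lowerSum_moebiusInverse, Φ.val_empty]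
  val_disjUnion x y c d :=
    moebiusInverse_disjUnion hp _ _ _ (fun x y => Φ.val_disjUnion x y c d) x y

/-- The distribution with given free cumulants. -/
noncomputable def ofCumulants [NeZero p] (hp : Even p) (K : TensorDistribution p ι) :
    TensorDistribution p ι where
  val x c := lowerSum (fun y => K.val y c) x
  iso_inv {V W} _ _ x y e c := by
    have h := e.eq_relabel
    obtain ⟨e, s, hes⟩ := e
    dsimp only at h ⊢
    subst h
    rw [lowerSum_relabel]
    congr 1
    funext z
    exact K.iso_inv z _ (relabelIso e s z) c
  val_empty x c := by rw [lowerSum_eq_of_isEmpty, K.val_empty]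
  val_disjUnion x y c d :=
    lowerSum_mul_disjUnion hp _ _ _ (fun x y => K.val_disjUnion x y c d) x y

theorem freeCumulant_ofCumulants [NeZero p] (hp : Even p) (K : TensorDistribution p ι) {V : Type}
    [Finite V] (x : TraceMap p V) (c : V → ι) : (ofCumulants hp K).freeCumulant x c = K.val x c :=
  moebiusInverse_lowerSum _ x

/-- The product over the components of a weight depending only on the decoration. -/
noncomputable def componentProduct [NeZero p] (w : ∀ {V : Type} [Finite V], (V → ι) → ℝ)
    (hw : ∀ {V W : Type} [Finite V] [Finite W] (e : V ≃ W) (c : W → ι),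
      w (fun v => c (e v)) = w c) : TensorDistribution p ι where
  val {V} _ x c := ∏ᶠ q : Quotient x.component,
    w fun v : {v : V // Quotient.mk x.component v = q} => c v
  iso_inv {V W} _ _ x y e c := by
    rw [← finprod_comp_equiv (Quotient.congr e.vert fun v w => (e.component_iff v w).symm)]
    refine finprod_congr fun q => ?_
    refine hw (e.vert.subtypeEquiv (p := fun v => Quotient.mk x.component v = q)
      (q := fun w => Quotient.mk y.component w =
        Quotient.congr e.vert (fun v w => (e.component_iff v w).symm) q) fun v => ?_)
      (fun w => c w.1)
    induction q using Quotient.inductionOn with | _ u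
    simp only [Quotient.congr_mk]
    exact (Quotient.eq (r := x.component)).trans
      ((e.component_iff v u).symm.trans (Quotient.eq (r := y.component)).symm)
  val_empty {V} _ _ x c := by
    have : IsEmpty (Quotient x.component) := Quotient.mk_surjective.isEmpty
    exact finprod_of_isEmpty _
  val_disjUnion {V W} _ _ x y c d := by
    have := Fintype.ofFinite V
    have := Fintype.ofFinite W
    rw [← finprod_comp_equiv (disjUnionComponents x y).symm, finprod_eq_prod_of_fintype,
      Fintype.prod_sum_type, finprod_eq_prod_of_fintype, finprod_eq_prod_of_fintype]
    congr 1
    · refine Finset.prod_congr rfl fun q _ => ?_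
      rw [← hw (Equiv.ofBijective (fun v : {v : V // Quotient.mk x.component v = q} =>
        (⟨Sum.inl v.1, by
          rw [Equiv.eq_symm_apply, disjUnionComponents_mk, Sum.map_inl, v.2]⟩ :
          {u : V ⊕ W // Quotient.mk (x.disjUnion y).component u =
            (disjUnionComponents x y).symm (Sum.inl q)})) ⟨?_, ?_⟩)]
      · rfl
      · intro a b h
        exact Subtype.ext (Sum.inl_injective (congrArg Subtype.val h))
      · rintro ⟨v | v, hv⟩ <;>
          rw [Equiv.eq_symm_apply, disjUnionComponents_mk] at hv
        · exact ⟨⟨v, Sum.inl_injective hv⟩, rfl⟩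
        · simp at hv
    · refine Finset.prod_congr rfl fun q _ => ?_
      rw [← hw (Equiv.ofBijective (fun v : {v : W // Quotient.mk y.component v = q} =>
        (⟨Sum.inr v.1, by
          rw [Equiv.eq_symm_apply, disjUnionComponents_mk, Sum.map_inr, v.2]⟩ :
          {u : V ⊕ W // Quotient.mk (x.disjUnion y).component u =
            (disjUnionComponents x y).symm (Sum.inr q)})) ⟨?_, ?_⟩)]
      · rfl
      · intro a b h
        exact Subtype.ext (Sum.inr_injective (congrArg Subtype.val h))
      · rintro ⟨v | v, hv⟩ <;>
          rw [Equiv.eq_symm_apply, disjUnionComponents_mk] at hv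
        · simp at hv
        · exact ⟨⟨v, Sum.inr_injective hv⟩, rfl⟩

theorem componentProduct_of_connected [NeZero p] (w : ∀ {V : Type} [Finite V], (V → ι) → ℝ)
    (hw : ∀ {V W : Type} [Finite V] [Finite W] (e : V ≃ W) (c : W → ι),
      w (fun v => c (e v)) = w c) {V : Type} [Finite V] {x : TraceMap p V} (hx : x.Connected)
    (c : V → ι) : (componentProduct w hw).val x c = w c := by
  obtain ⟨h1, ⟨v⟩⟩ := component_eq_top_iff.1 hx
  have hsub : ∀ q r : Quotient x.component, q = r := by
    intro q r
    induction q using Quotient.inductionOn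
    induction r using Quotient.inductionOn
    exact Quotient.sound (Setoid.eq_top_iff.1 h1 _ _)
  have : Unique (Quotient x.component) := ⟨⟨Quotient.mk _ v⟩, fun q => hsub _ _⟩
  change ∏ᶠ q : Quotient x.component, _ = _
  rw [finprod_unique, ← hw (Equiv.subtypeUnivEquiv fun v => hsub _ _) c]
  rfl

/-- The sum of the values at the maps with `b` components. -/
noncomputable def componentSum (Φ : TensorDistribution p Unit) (b : ℕ) (V : Type) [Finite V] : ℝ :=
  ∑ y : TraceMap p V with y.numComponents = b, Φ.val y fun _ => ()

theorem componentSum_congr [NeZero p] (Φ : TensorDistribution p Unit) (b : ℕ) {V W : Type}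
    [Finite V] [Finite W] (e : V ≃ W) : Φ.componentSum b V = Φ.componentSum b W := by
  refine Finset.sum_bij (fun y _ => relabel e 0 y) ?_ (fun _ _ _ _ h => (relabel e 0).injective h)
    ?_ ?_
  · intro y hy
    simpa [numComponents_relabel] using hy
  · intro y hy
    refine ⟨(relabel e 0).symm y, ?_, by simp⟩
    rw [Finset.mem_filter] at hy ⊢
    rw [← numComponents_relabel e 0]
    simpa using hy
  · intro y _
    exact Φ.iso_inv y _ (relabelIso e 0 y) fun _ => ()

theorem componentSum_card [NeZero p] (Φ : TensorDistribution p Unit) (b : ℕ) (V : Type)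
    [Finite V] : Φ.componentSum b V = Φ.componentSum b (Fin (Nat.card V)) :=
  Φ.componentSum_congr b (Finite.equivFin V)

end TensorDistribution

/-! ### Splitting off a component -/

namespace TraceMap

open Classical

variable {p : ℕ} {V : Type}

/-- `S` is the vertex set of a component of `y`. -/
def IsComponent (y : TraceMap p V) (S : Finset V) : Prop :=
  ∃ v, ∀ w, w ∈ S ↔ y.component v w

theorem card_isComponent [Fintype V] (y : TraceMap p V) :
    (Finset.univ.filter fun S : Finset V => y.IsComponent S).card = y.numComponents := by
  rw [numComponents, Nat.card_eq_fintype_card, ← Finset.card_univ]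
  symm
  refine Finset.card_bij (fun q _ => Finset.univ.filter fun w => Quotient.mk y.component w = q)
    ?_ ?_ ?_
  · intro q _
    induction q using Quotient.inductionOn with | _ v
    rw [Finset.mem_filter]
    refine ⟨Finset.mem_univ _, v, fun w => ?_⟩
    simp only [Finset.mem_filter, Finset.mem_univ, true_and]
    exact (Quotient.eq (r := y.component)).trans ⟨y.component.symm, y.component.symm⟩
  · intro q _ r _ h
    induction q using Quotient.inductionOn with | _ v
    have := Finset.ext_iff.1 h v
    simpa using this
  · intro S hS
    obtain ⟨v, hv⟩ := (Finset.mem_filter.1 hS).2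
    refine ⟨Quotient.mk _ v, Finset.mem_univ _, ?_⟩
    ext w
    rw [hv]
    simp only [Finset.mem_filter, Finset.mem_univ, true_and]
    exact (Quotient.eq (r := y.component)).trans ⟨y.component.symm, y.component.symm⟩

/-- The disjoint union of a map on `S` and a map on the complement of `S`. -/
noncomputable def join [NeZero p] (S : Finset V) (y : TraceMap p {v // v ∈ S})
    (z : TraceMap p {v // v ∉ S}) : TraceMap p V :=
  relabel (Equiv.sumCompl fun v => v ∈ S) 0 (y.disjUnion z)

theorem join_isComponent [NeZero p] {S : Finset V} {y : TraceMap p {v // v ∈ S}}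
    (z : TraceMap p {v // v ∉ S}) (hy : y.Connected) : (join S y z).IsComponent S := by
  obtain ⟨h1, ⟨v⟩⟩ := component_eq_top_iff.1 hy
  refine ⟨v, fun w => ?_⟩
  obtain ⟨w, rfl⟩ := (Equiv.sumCompl fun v => v ∈ S).surjective w
  have : (v : V) = Equiv.sumCompl (fun v => v ∈ S) (Sum.inl v) := by simp
  rw [this, join, relabel_component, disjUnion_component, Setoid.ker_def]
  rcases w with w | w
  · simp only [Equiv.sumCompl_apply_inl, w.2, true_iff, Sum.map_inl, Sum.inl.injEq]
    exact Quotient.sound (Setoid.eq_top_iff.1 h1 _ _)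
  · simp [w.2]

theorem exists_eq_join [NeZero p] [Finite V] {S : Finset V} {x : TraceMap p V}
    (hx : x.IsComponent S) : ∃ y z, x = join S y z ∧ y.Connected := by
  obtain ⟨v, hv⟩ := hx
  set e := Equiv.sumCompl fun v => v ∈ S with he
  have hrel : ∀ a b, ((relabel e 0).symm x).component a b ↔ x.component (e a) (e b) := by
    intro a b
    rw [← relabel_component e 0, Equiv.apply_symm_apply]
  obtain ⟨y, z, hyz⟩ := exists_eq_disjUnion ((relabel e 0).symm x) (by
    intro h
    have h1 := (hrel _ _).1 (((relabel e 0).symm x).component_rel h)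
    have h2 : e h.1 ∈ S ↔ e (((relabel e 0).symm x).α h).1 ∈ S := by
      rw [hv, hv]
      exact ⟨fun H => Setoid.trans' _ H h1, fun H => Setoid.trans' _ H (Setoid.symm' _ h1)⟩
    have h3 : ∀ a, e a ∈ S ↔ a.isLeft := by
      rintro (a | a)
      · simp [he, a.2]
      · simp [he, a.2]
    rw [h3, h3] at h2
    exact (Bool.eq_iff_iff.2 h2).symm)
  refine ⟨y, z, ?_, component_eq_top_iff.2 ⟨?_, ⟨⟨v, (hv v).2 (Setoid.refl' _ v)⟩⟩⟩⟩
  · rw [join, ← hyz, Equiv.apply_symm_apply]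
  · rw [Setoid.eq_top_iff]
    intro a b
    have h1 : x.component (e (Sum.inl a)) (e (Sum.inl b)) := by
      have ha := (hv a).1 a.2
      have hb := (hv b).1 b.2
      simpa [he] using Setoid.trans' _ (Setoid.symm' _ ha) hb
    rw [← hrel, hyz, disjUnion_component, Setoid.ker_def] at h1
    exact Quotient.exact (Sum.inl_injective h1)

theorem numComponents_join [NeZero p] [Finite V] (S : Finset V) (y : TraceMap p {v // v ∈ S})
    (z : TraceMap p {v // v ∉ S}) :
    (join S y z).numComponents = y.numComponents + z.numComponents := by
  rw [join, numComponents_relabel, numComponents_disjUnion]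

end TraceMap

/-! ### The exponential formula -/

namespace TensorDistribution

open Classical TraceMap

variable {p : ℕ} (Φ : TensorDistribution p Unit)

/-- The exponential generating series of the sums over the maps with `b` components. -/
noncomputable def componentSeries (b : ℕ) : PowerSeries ℝ :=
  PowerSeries.mk fun n => Φ.componentSum b (Fin n) / n.factorial

theorem componentSeries_zero : Φ.componentSeries 0 = 1 := by
  ext n
  rw [componentSeries, PowerSeries.coeff_mk, PowerSeries.coeff_one]
  split_ifs with h
  · subst h
    have hsub : ∀ x y : TraceMap p (Fin 0), x = y := fun x y =>
      TraceMap.ext (funext fun h => isEmptyElim h.1)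
    let x0 : TraceMap p (Fin 0) := ⟨fun h => isEmptyElim h.1, fun h => isEmptyElim h.1,
      fun h => isEmptyElim h.1⟩
    have : (Finset.univ.filter fun y : TraceMap p (Fin 0) => y.numComponents = 0) = {x0} := by
      ext y
      have := numComponents_le y
      simp only [Nat.card_eq_fintype_card, Fintype.card_fin] at this
      simp [hsub y x0, Nat.le_zero.1 (hsub y x0 ▸ this)]
    rw [componentSum, this, Finset.sum_singleton, Φ.val_empty]
    simp
  · have : (Finset.univ.filter fun y : TraceMap p (Fin n) => y.numComponents = 0) = ∅ := by
      rw [Finset.filter_eq_empty_iff]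
      intro y _ hy
      have : Nonempty (Quotient y.component) := ⟨Quotient.mk _ ⟨0, Nat.pos_of_ne_zero h⟩⟩
      exact (Nat.card_pos (α := Quotient y.component)).ne' hy
    rw [componentSum, this]
    simp

variable [NeZero p]

theorem val_join {V : Type} [Finite V] (S : Finset V) (y : TraceMap p {v // v ∈ S})
    (z : TraceMap p {v // v ∉ S}) :
    Φ.val (join S y z) (fun _ => ()) = Φ.val y (fun _ => ()) * Φ.val z (fun _ => ()) := by
  rw [join, ← Φ.val_disjUnion]
  exact (Φ.iso_inv _ _ (relabelIso _ _ _) fun _ => ()).symm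

/-- Each map with `k + 1` components is counted once for each choice of a distinguished component
`S`; the rest is a map with `k` components on the complement. -/
theorem succ_mul_componentSum (k : ℕ) (V : Type) [Fintype V] :
    (k + 1) * Φ.componentSum (k + 1) V =
      ∑ S : Finset V, Φ.componentSum 1 {v // v ∈ S} * Φ.componentSum k {v // v ∉ S} := by
  have h1 : (k + 1) * Φ.componentSum (k + 1) V =
      ∑ S : Finset V, ∑ y : TraceMap p V with y.numComponents = k + 1 ∧ y.IsComponent S,
        Φ.val y fun _ => () := by
    have h2 : ∀ S : Finset V, (∑ y : TraceMap p V with y.numComponents = k + 1 ∧ y.IsComponent S,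
        Φ.val y fun _ => ()) = ∑ y : TraceMap p V with y.numComponents = k + 1,
          if y.IsComponent S then Φ.val y fun _ => () else 0 := by
      intro S
      rw [← Finset.filter_filter, Finset.sum_filter]
    rw [Finset.sum_congr rfl fun S _ => h2 S, Finset.sum_comm, componentSum, Finset.mul_sum]
    refine Finset.sum_congr rfl fun y hy => ?_
    rw [← Finset.sum_filter, Finset.sum_const, card_isComponent, (Finset.mem_filter.1 hy).2]
    simp
  rw [h1]
  refine Finset.sum_congr rfl fun S _ => ?_
  rw [componentSum, componentSum, Finset.sum_mul_sum, ← Finset.sum_product']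
  symm
  refine Finset.sum_bij (fun q _ => join S q.1 q.2) ?_ ?_ ?_ ?_
  · rintro ⟨y, z⟩ h
    simp only [Finset.mem_product, Finset.mem_filter, Finset.mem_univ, true_and] at h ⊢
    refine ⟨?_, join_isComponent z h.1⟩
    rw [numComponents_join, h.1, h.2, add_comm]
  · rintro ⟨y, z⟩ _ ⟨y', z'⟩ _ h
    have := disjUnion_injective ((relabel _ _).injective h)
    exact Prod.ext this.1 this.2
  · intro x hx
    obtain ⟨h2, h3⟩ := (Finset.mem_filter.1 hx).2
    obtain ⟨y, z, rfl, hy⟩ := exists_eq_join h3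
    rw [numComponents_join, hy] at h2
    refine ⟨(y, z), ?_, rfl⟩
    simp only [Finset.mem_product, Finset.mem_filter, Finset.mem_univ, true_and]
    exact ⟨hy, by omega⟩
  · rintro ⟨y, z⟩ _
    exact (Φ.val_join S y z).symm

/-- The sums depend only on `S.card`, so the sum over subsets is a binomial convolution, that is, a
product of exponential generating series. -/
theorem succ_mul_componentSeries (k : ℕ) :
    ((k + 1 : ℕ) : PowerSeries ℝ) * Φ.componentSeries (k + 1) =
      Φ.componentSeries 1 * Φ.componentSeries k := by
  ext n
  rw [← map_natCast (PowerSeries.C (R := ℝ)), PowerSeries.coeff_C_mul, PowerSeries.coeff_mul]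
  simp only [componentSeries, PowerSeries.coeff_mk]
  have h := Φ.succ_mul_componentSum k (Fin n)
  have h2 : ∀ S : Finset (Fin n),
      Φ.componentSum 1 {v // v ∈ S} * Φ.componentSum k {v // v ∉ S} =
        Φ.componentSum 1 (Fin S.card) * Φ.componentSum k (Fin (n - S.card)) := by
    intro S
    rw [Φ.componentSum_card 1 {v // v ∈ S}, Φ.componentSum_card k {v // v ∉ S}]
    have e1 : Nat.card {v // v ∈ S} = S.card := by simp
    have e2 : Nat.card {v // v ∉ S} = n - S.card := by
      rw [Nat.card_eq_fintype_card, Fintype.card_subtype_compl]; simp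
    rw [e1, e2]
  have h3 := Finset.sum_powerset_apply_card
    (fun m => Φ.componentSum 1 (Fin m) * Φ.componentSum k (Fin (n - m)))
    (x := (Finset.univ : Finset (Fin n)))
  rw [Finset.powerset_univ, Finset.card_univ, Fintype.card_fin] at h3
  rw [Finset.sum_congr rfl fun S _ => h2 S, h3] at h
  rw [Finset.Nat.sum_antidiagonal_eq_sum_range_succ_mk]
  push_cast
  rw [← mul_div_assoc, h, Finset.sum_div]
  refine Finset.sum_congr rfl fun m hm => ?_
  have hm : m ≤ n := Nat.lt_succ_iff.1 (Finset.mem_range.1 hm)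
  rw [nsmul_eq_mul, Nat.cast_choose ℝ hm]
  have a1 : (n.factorial : ℝ) ≠ 0 := by positivity
  have a2 : (m.factorial : ℝ) ≠ 0 := by positivity
  have a3 : ((n - m).factorial : ℝ) ≠ 0 := by positivity
  field_simp

theorem factorial_mul_componentSeries (b : ℕ) :
    ((b.factorial : ℕ) : PowerSeries ℝ) * Φ.componentSeries b = Φ.componentSeries 1 ^ b := by
  induction b with
  | zero => simp [componentSeries_zero]
  | succ k ih =>
    rw [pow_succ, ← ih, Nat.factorial_succ, Nat.mul_comm, Nat.cast_mul, mul_assoc,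
      succ_mul_componentSeries]
    ring

end TensorDistribution

/-! ### Moment sums of power series and the Poisson series -/

section series

open PowerSeries

/-- The `n`-th moment, up to normalization, for the series `A` of free cumulants. -/
noncomputable def momentSum (q n : ℕ) (A : PowerSeries ℝ) : ℝ :=
  ∑ b ∈ Finset.Icc 1 n, ((q * n).descFactorial (b - 1) : ℝ) / b.factorial * coeff n (A ^ b)

theorem coeff_pow_eq_of_coeff_eq {A B : PowerSeries ℝ} (hA : coeff 0 A = 0) (hB : coeff 0 B = 0)
    {n : ℕ} (h : ∀ m < n, coeff m A = coeff m B) {b : ℕ} (hb : 2 ≤ b) :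
    coeff n (A ^ b) = coeff n (B ^ b) := by
  obtain ⟨k, rfl⟩ := Nat.exists_eq_add_of_le' hb
  have h1 : X ^ n ∣ A - B := X_pow_dvd_iff.2 fun m hm => by rw [map_sub, h m hm, sub_self]
  have h2 : X ∣ A := X_dvd_iff.2 (by simpa using hA)
  have h3 : X ∣ B := X_dvd_iff.2 (by simpa using hB)
  have h4 : X ^ (n + 1) ∣ A ^ (k + 2) - B ^ (k + 2) := by
    -- In each product one factor is divisible by `X ^ n` and the other by `X`, which gains the one
    -- extra order needed at degree `n`.
    have e : A ^ (k + 2) - B ^ (k + 2) =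
        (A ^ (k + 1) - B ^ (k + 1)) * A + (A - B) * B ^ (k + 1) := by ring
    rw [e, pow_succ]
    exact dvd_add (mul_dvd_mul (h1.trans (sub_dvd_pow_sub_pow _ _ _)) h2)
      (mul_dvd_mul h1 (h3.trans (dvd_pow_self _ (Nat.succ_ne_zero k))))
  have h5 := X_pow_dvd_iff.1 h4 n (Nat.lt_succ_self n)
  rwa [map_sub, sub_eq_zero] at h5

/-- The moments determine the free cumulants. -/
theorem eq_of_momentSum_eq {q : ℕ} {A B : PowerSeries ℝ} (hA : coeff 0 A = 0) (hB : coeff 0 B = 0)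
    (h : ∀ n, 1 ≤ n → momentSum q n A = momentSum q n B) : A = B := by
  ext n
  induction n using Nat.strong_induction_on with | _ n ih
  rcases Nat.eq_zero_or_pos n with rfl | hn
  · rw [hA, hB]
  have h1 := h n hn
  have hmem : 1 ∈ Finset.Icc 1 n := Finset.mem_Icc.2 ⟨le_rfl, hn⟩
  -- The term `b = 1` has coefficient one and isolates the `n`-th coefficient; the others agree by
  -- induction.
  rw [momentSum, momentSum, ← Finset.add_sum_erase _ _ hmem, ← Finset.add_sum_erase _ _ hmem,
    Finset.sum_congr rfl (g := fun b : ℕ => ((q * n).descFactorial (b - 1) : ℝ) / b.factorial *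
      coeff n (B ^ b))] at h1
  · simpa using h1
  · intro b hb
    simp only [Finset.mem_erase, Finset.mem_Icc] at hb
    rw [coeff_pow_eq_of_coeff_eq hA hB ih (by omega)]

/-- The series of free cumulants of the free Poisson law. -/
noncomputable def poissonSeries (p : ℕ) (t : ℝ) : PowerSeries ℝ :=
  PowerSeries.mk fun n => if n = 0 then 0 else t * p ^ n

/-- The closed form `t p X / (1 - p X)` gives the powers by the negative binomial series. -/
theorem poissonSeries_eq (p : ℕ) (t : ℝ) :
    poissonSeries p t = C t * rescale (p : ℝ) (X * PowerSeries.mk 1) := by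
  ext n
  rw [poissonSeries, coeff_mk, coeff_C_mul, coeff_rescale]
  rcases n with _ | n
  · simp
  · rw [coeff_succ_X_mul]; simp

theorem coeff_poissonSeries_pow (p : ℕ) (t : ℝ) {n b : ℕ} (hb : 1 ≤ b) (hbn : b ≤ n) :
    coeff n (poissonSeries p t ^ b) = p ^ n * (t ^ b * (n - 1).choose (b - 1)) := by
  obtain ⟨k, rfl⟩ := Nat.exists_eq_add_of_le' hb
  rw [poissonSeries_eq, mul_pow, ← map_pow, ← map_pow, coeff_C_mul, coeff_rescale, mul_pow,
    coeff_X_pow_mul', if_pos hbn, mk_one_pow_eq_mk_choose_add, coeff_mk]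
  rw [show k + (n - (k + 1)) = n - 1 by omega, Nat.add_sub_cancel]
  ring

theorem momentSum_poissonSeries (p q n : ℕ) (t : ℝ) :
    momentSum q n (poissonSeries p t) = p ^ n * fussNarayana q n t := by
  rw [momentSum, fussNarayana, Finset.mul_sum]
  refine Finset.sum_congr rfl fun b hb => ?_
  rw [Finset.mem_Icc] at hb
  rw [coeff_poissonSeries_pow p t hb.1 hb.2]
  obtain ⟨k, rfl⟩ := Nat.exists_eq_add_of_le' hb.1
  rw [Nat.add_sub_cancel, Nat.descFactorial_eq_factorial_mul_choose, Nat.factorial_succ]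
  push_cast
  have h1 : (k.factorial : ℝ) ≠ 0 := by positivity
  have h2 : (k : ℝ) + 1 ≠ 0 := by positivity
  field_simp

theorem poissonSeries_add (p : ℕ) (t t' : ℝ) :
    poissonSeries p t + poissonSeries p t' = poissonSeries p (t + t') := by
  ext n
  simp only [poissonSeries, map_add, coeff_mk]
  split_ifs <;> ring

end series

/-! ### Cumulant series: additivity and the moment formula -/

namespace TensorDistribution

open Classical TraceMap

variable {p : ℕ}

/-- Möbius inversion is linear, so the cumulant of the sum is the sum over all decorations; freeness
leaves only the two constant ones. -/
theorem freeCumulant_total_of_isFree {Φ : TensorDistribution p (Fin 2)} (hΦ : Φ.IsFree)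
    {V : Type} [Finite V] {x : TraceMap p V} (hx : x.Connected) (c : V → Unit) :
    Φ.total.freeCumulant x c = Φ.freeCumulant x (fun _ => 0) + Φ.freeCumulant x fun _ => 1 := by
  have := Fintype.ofFinite V
  obtain ⟨-, ⟨v0⟩⟩ := component_eq_top_iff.1 hx
  have e : (fun y => Φ.total.val y c) = fun y : TraceMap p V => ∑ d : V → Fin 2, Φ.val y d := by
    funext y
    exact finsum_eq_sum_of_fintype _
  rw [freeCumulant, e, moebiusInverse_sum]
  change ∑ d : V → Fin 2, Φ.freeCumulant x d = _
  rw [← Fin.sum_univ_two fun i : Fin 2 => Φ.freeCumulant x fun _ => i]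
  symm
  rw [← Finset.sum_image (s := Finset.univ) (g := fun (i : Fin 2) (_ : V) => i)
    (f := fun d => Φ.freeCumulant x d)]
  · refine Finset.sum_subset (Finset.subset_univ _) fun d _ hd => ?_
    refine hΦ V x d hx ?_
    by_contra! H
    exact hd (Finset.mem_image.2 ⟨d v0, Finset.mem_univ _, funext fun v => H v0 v⟩)
  · intro i _ j _ h
    exact congrFun h v0

variable [NeZero p]

/-- The weight that multiplies, over the components, the number of their half-edges. -/
noncomputable def halfEdgeWeight (p : ℕ) [NeZero p] : TensorDistribution p Unit :=
  componentProduct (fun {V} _ _ => (p : ℝ) * Nat.card V) fun e _ => by rw [Nat.card_congr e]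

theorem halfEdgeWeight_val {V : Type} [Finite V] (y : TraceMap p V) (c : V → Unit) :
    (halfEdgeWeight p).val y c =
      ((∏ᶠ q : Quotient y.component, p * Nat.card {v // Quotient.mk y.component v = q} : ℕ) : ℝ)
    := by
  have := Fintype.ofFinite V
  change ∏ᶠ q : Quotient y.component, (p : ℝ) * Nat.card _ = _
  rw [finprod_eq_prod_of_fintype, finprod_eq_prod_of_fintype]
  push_cast
  rfl

theorem halfEdgeWeight_of_connected {V : Type} [Finite V] {y : TraceMap p V} (hy : y.Connected)
    (c : V → Unit) : (halfEdgeWeight p).val y c = p * Nat.card V :=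
  componentProduct_of_connected (fun {V} _ _ => (p : ℝ) * Nat.card V)
    (fun e _ => by rw [Nat.card_congr e]) hy c

/-- The free cumulants, weighted by the numbers of half-edges of the components. -/
noncomputable def weightedCumulants (hp : Even p) (Φ : TensorDistribution p Unit) :
    TensorDistribution p Unit := (Φ.cumulants hp).mul (halfEdgeWeight p)

/-- The series of the free cumulants summed over the connected maps. -/
noncomputable def cumulantSeries (hp : Even p) (Φ : TensorDistribution p Unit) : PowerSeries ℝ :=
  (Φ.weightedCumulants hp).componentSeries 1

theorem coeff_cumulantSeries (hp : Even p) (Φ : TensorDistribution p Unit) (n : ℕ) :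
    PowerSeries.coeff n (Φ.cumulantSeries hp) =
      (∑ y : TraceMap p (Fin n) with y.Connected, Φ.freeCumulant y fun _ => ()) * (p * n) /
        n.factorial := by
  rw [cumulantSeries, componentSeries, PowerSeries.coeff_mk, componentSum, Finset.sum_mul]
  congr 1
  refine Finset.sum_congr
    (Finset.ext fun _ => by rw [Finset.mem_filter, Finset.mem_filter, Connected]) fun y hy => ?_
  have hy : y.Connected := (Finset.mem_filter.1 hy).2
  change _ * (halfEdgeWeight p).val y _ = _
  rw [halfEdgeWeight_of_connected hy]
  simp [cumulants]

theorem coeff_zero_cumulantSeries (hp : Even p) (Φ : TensorDistribution p Unit) :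
    PowerSeries.coeff 0 (Φ.cumulantSeries hp) = 0 := by
  rw [coeff_cumulantSeries]
  simp

/-- The number of connected maps above `y` splits into a product over the components, absorbed in
the weighted cumulants, and a factor depending only on how many components there are. Grouping by
that number leaves exactly the sums governed by the exponential formula. -/
theorem moment_eq_momentSum (hp : Even p) (Φ : TensorDistribution p Unit) {n : ℕ} (hn : 1 ≤ n) :
    (p : ℝ) ^ n * Φ.moment n = momentSum (p / 2) n (Φ.cumulantSeries hp) := by
  have : Nonempty (Fin n) := ⟨⟨0, hn⟩⟩
  have hcard : Nat.card (Fin n) = n := by simp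
  have h0 := Φ.factorial_mul_moment (n := n) (by omega)
  set Ω := Φ.weightedCumulants hp with hΩ
  have h1 : (p * n : ℝ) * ∑ x : TraceMap p (Fin n) with x.Connected, Φ.val x (fun _ => ()) =
      ∑ y : TraceMap p (Fin n),
        ((p / 2 * n).descFactorial (y.numComponents - 1) : ℝ) * Ω.val y fun _ => () := by
    have e1 : ∀ x : TraceMap p (Fin n), Φ.val x (fun _ => ()) =
        ∑ y, if BelowEq y x then Φ.freeCumulant y fun _ => () else 0 := by
      intro x
      rw [← Finset.sum_filter]
      exact eq_lowerSum_moebiusInverse (fun y => Φ.val y fun _ => ()) x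
    -- After the exchange of sums, each cumulant `κ_y` is multiplied by the number of connected maps
    -- above `y`.
    rw [Finset.sum_congr rfl fun x _ => e1 x, Finset.sum_comm, Finset.mul_sum]
    refine Finset.sum_congr rfl fun y _ => ?_
    rw [← Finset.sum_filter, Finset.filter_filter, Finset.sum_const, nsmul_eq_mul, ← mul_assoc]
    have h2 := card_connected_above hp (Nat.pos_of_neZero p) y
    rw [hcard] at h2
    have h3 := congrArg (Nat.cast (R := ℝ)) h2
    rw [Nat.cast_mul, Nat.cast_mul, Nat.cast_mul, ← halfEdgeWeight_val y fun _ => ()] at h3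
    rw [h3]
    change _ = _ * (Φ.freeCumulant y _ * (halfEdgeWeight p).val y _)
    ring
  have h2 : ∑ y : TraceMap p (Fin n),
        ((p / 2 * n).descFactorial (y.numComponents - 1) : ℝ) * Ω.val y (fun _ => ()) =
      ∑ b ∈ Finset.Icc 1 n, ((p / 2 * n).descFactorial (b - 1) : ℝ) * Ω.componentSum b (Fin n) := by
    rw [← Finset.sum_fiberwise_of_maps_to (t := Finset.Icc 1 n)
      (g := fun y : TraceMap p (Fin n) => y.numComponents)]
    · refine Finset.sum_congr rfl fun b _ => ?_
      rw [componentSum, Finset.mul_sum]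
      refine Finset.sum_congr rfl fun y hy => ?_
      rw [(Finset.mem_filter.1 hy).2]
    · intro y _
      rw [Finset.mem_Icc]
      have : Nonempty (Quotient y.component) := ⟨Quotient.mk _ ⟨0, hn⟩⟩
      exact ⟨Nat.card_pos, by simpa using numComponents_le y⟩
  rw [h1, h2] at h0
  have hfact : (n.factorial : ℝ) ≠ 0 := by positivity
  refine mul_left_cancel₀ hfact ?_
  rw [← mul_assoc, h0, momentSum, Finset.mul_sum]
  refine Finset.sum_congr rfl fun b _ => ?_
  rw [cumulantSeries, ← hΩ, ← factorial_mul_componentSeries,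
    ← map_natCast (PowerSeries.C (R := ℝ)), PowerSeries.coeff_C_mul, componentSeries,
    PowerSeries.coeff_mk]
  have hb : (b.factorial : ℝ) ≠ 0 := by positivity
  field_simp

theorem moments_eq_fussNarayana_iff (hp : Even p) (Φ : TensorDistribution p Unit) (t : ℝ) :
    (∀ n, 1 ≤ n → Φ.moment n = fussNarayana (p / 2) n t) ↔
      Φ.cumulantSeries hp = poissonSeries p t := by
  have hp0 : ∀ n, (p : ℝ) ^ n ≠ 0 := fun n =>
    pow_ne_zero _ (Nat.cast_ne_zero.2 (NeZero.ne p))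
  constructor
  · intro h
    refine eq_of_momentSum_eq (q := p / 2) (Φ.coeff_zero_cumulantSeries hp)
      (by simp [poissonSeries]) fun n hn => ?_
    rw [← Φ.moment_eq_momentSum hp hn, h n hn, momentSum_poissonSeries]
  · intro h n hn
    refine mul_left_cancel₀ (hp0 n) ?_
    rw [Φ.moment_eq_momentSum hp hn, h, momentSum_poissonSeries]

theorem cumulantSeries_total (hp : Even p) {Φ : TensorDistribution p (Fin 2)} (hΦ : Φ.IsFree) :
    Φ.total.cumulantSeries hp =
      (Φ.marginal 0).cumulantSeries hp + (Φ.marginal 1).cumulantSeries hp := by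
  ext n
  rw [map_add, coeff_cumulantSeries, coeff_cumulantSeries, coeff_cumulantSeries, ← add_div,
    ← add_mul, ← Finset.sum_add_distrib]
  congr 2
  exact Finset.sum_congr rfl fun y hy =>
    freeCumulant_total_of_isFree hΦ (Finset.mem_filter.1 hy).2 _

end TensorDistribution

/-! ### Existence of free Poisson families -/

namespace TraceMap

variable {p : ℕ}

/-- In a map with the fewest components no switch can merge two of them. Existence makes the
denominator `numConnected` of the Poisson cumulants nonzero. -/
theorem exists_connected (hp : Even p) (hp0 : 0 < p) (V : Type) [Finite V] [Nonempty V] :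
    ∃ x : TraceMap p V, x.Connected := by
  -- Reversing the half-edges at each vertex has no fixed point because `p` is even.
  let x0 : TraceMap p V := ⟨fun h => (h.1, h.2.rev), fun h => by simp, fun h e => by
    have := congrArg (fun a => (Prod.snd a).val) e
    simp only [Fin.val_rev] at this
    obtain ⟨q, rfl⟩ := hp
    omega⟩
  obtain ⟨x, -, hx⟩ := Set.exists_min_image Set.univ (fun x : TraceMap p V => x.numComponents)
    Set.finite_univ ⟨x0, Set.mem_univ _⟩
  refine ⟨x, component_eq_top_iff.2 ⟨Setoid.eq_top_iff.2 fun v w => ?_, inferInstance⟩⟩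
  by_contra h
  have h1 := numComponents_switch hp x (h := (v, ⟨0, hp0⟩)) (k := (w, ⟨0, hp0⟩)) h
  have h2 := hx (x.switch (v, ⟨0, hp0⟩) (w, ⟨0, hp0⟩)) (Set.mem_univ _)
  omega

end TraceMap

namespace TensorDistribution

open Classical TraceMap

variable {p : ℕ} [NeZero p]

/-- The number of connected maps with `n` labelled vertices. -/
noncomputable def numConnected (p n : ℕ) : ℕ :=
  (Finset.univ.filter fun x : TraceMap p (Fin n) => x.Connected).card

/-- A weight that vanishes unless all vertices have the same letter `i`; the connected maps with `n`
vertices share it equally, with sum determined by `t i`. -/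
noncomputable def letterWeight (p : ℕ) {ι : Type} [Fintype ι] (t : ι → ℝ) {V : Type} [Finite V]
    (c : V → ι) : ℝ :=
  ∑ i, if ∀ v, c v = i then
    t i * ((p : ℝ) ^ Nat.card V * (Nat.card V).factorial /
      (numConnected p (Nat.card V) * (p * Nat.card V))) else 0

theorem letterWeight_comp (p : ℕ) {ι : Type} [Fintype ι] (t : ι → ℝ) {V W : Type} [Finite V]
    [Finite W] (e : V ≃ W) (c : W → ι) :
    letterWeight p t (fun v => c (e v)) = letterWeight p t c := by
  refine Finset.sum_congr rfl fun i _ => ?_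
  have h : (∀ v, c (e v) = i) ↔ ∀ w, c w = i := e.forall_congr_left.trans (by simp)
  simp only [Nat.card_congr e, h]

/-- The multiplicative free cumulants given by `letterWeight` on the components. -/
noncomputable def poissonCumulants (p : ℕ) [NeZero p] {ι : Type} [Fintype ι] (t : ι → ℝ) :
    TensorDistribution p ι :=
  componentProduct (letterWeight p t) (letterWeight_comp p t)

theorem freeCumulant_ofCumulants_poissonCumulants (hp : Even p) {ι : Type} [Fintype ι] (t : ι → ℝ)
    {V : Type} [Finite V] {x : TraceMap p V} (hx : x.Connected) (c : V → ι) :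
    (ofCumulants hp (poissonCumulants p t)).freeCumulant x c = letterWeight p t c := by
  rw [freeCumulant_ofCumulants]
  exact componentProduct_of_connected (letterWeight p t) (letterWeight_comp p t) hx c

/-- The joint distribution of free Poisson tensors with parameters `t i`. -/
noncomputable def poisson (hp : Even p) {ι : Type} [Fintype ι] (t : ι → ℝ) :
    TensorDistribution p ι := ofCumulants hp (poissonCumulants p t)

theorem poisson_isFree (hp : Even p) {ι : Type} [Fintype ι] (t : ι → ℝ) :
    (poisson hp t).IsFree := by
  intro V _ x c hx ⟨v, w, hvw⟩
  rw [poisson, freeCumulant_ofCumulants_poissonCumulants hp t hx]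
  refine Finset.sum_eq_zero fun i _ => if_neg fun h => hvw ?_
  rw [h v, h w]

/-- The normalization in `letterWeight` is the one that cancels the number of connected maps and the
factor `p n / n!`, leaving `t i * p ^ n`. -/
theorem cumulantSeries_poisson (hp : Even p) {ι : Type} [Fintype ι] (t : ι → ℝ) (i : ι) :
    ((poisson hp t).marginal i).cumulantSeries hp = poissonSeries p (t i) := by
  ext n
  rcases Nat.eq_zero_or_pos n with rfl | hn
  · rw [coeff_zero_cumulantSeries]
    simp [poissonSeries]
  have : Nonempty (Fin n) := ⟨⟨0, hn⟩⟩
  have hpos : (numConnected p n : ℝ) ≠ 0 := by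
    obtain ⟨x, hx⟩ := exists_connected hp (Nat.pos_of_neZero p) (Fin n)
    exact Nat.cast_ne_zero.2 (Finset.card_pos.2 ⟨x, by simp [hx]⟩).ne'
  have hval : ∀ y : TraceMap p (Fin n), y.Connected →
      ((poisson hp t).marginal i).freeCumulant y (fun _ => ()) =
        t i * ((p : ℝ) ^ n * n.factorial / (numConnected p n * (p * n))) := by
    intro y hy
    change (poisson hp t).freeCumulant y (fun _ => i) = _
    rw [poisson, freeCumulant_ofCumulants_poissonCumulants hp t hy]
    simp [letterWeight]
  rw [coeff_cumulantSeries, Finset.sum_congr rfl fun y hy => hval y (Finset.mem_filter.1 hy).2,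
    Finset.sum_const, nsmul_eq_mul, poissonSeries, PowerSeries.coeff_mk, if_neg hn.ne']
  change (numConnected p n : ℝ) * _ * _ / _ = _
  have h1 : (n.factorial : ℝ) ≠ 0 := by positivity
  have h2 : (n : ℝ) ≠ 0 := by positivity
  have h3 : (p : ℝ) ≠ 0 := Nat.cast_ne_zero.2 (NeZero.ne p)
  field_simp

theorem hasLaw_iff_of_cumulantSeries (hp : Even p) {a : TensorDistribution p Unit} {t : ℝ}
    (h : a.cumulantSeries hp = poissonSeries p t) (μ : Measure ℝ) :
    a.HasLaw μ ↔ IsFreePoissonLaw p t μ := by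
  have hm := (a.moments_eq_fussNarayana_iff hp t).2 h
  refine and_congr_right fun hμ => ⟨fun H n hn => (H n).trans (hm n hn), fun H n => ?_⟩
  -- The Poisson law prescribes moments only from `n = 1` on; the zeroth is the total mass.
  rcases Nat.eq_zero_or_pos n with rfl | hn
  · have := hμ.1
    simp [moment]
  · rw [H n hn, hm n hn]

theorem HasLaw.cumulantSeries_eq (hp : Even p) {a : TensorDistribution p Unit} {t : ℝ}
    {μ : Measure ℝ} (h : a.HasLaw μ) (hμ : IsFreePoissonLaw p t μ) :
    a.cumulantSeries hp = poissonSeries p t :=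
  (a.moments_eq_fussNarayana_iff hp t).1 fun n hn => (h.2 n).symm.trans (hμ.2 n hn)

end TensorDistribution

/-! ### Free convolution of free Poisson laws -/

theorem mainTheorem9 (p : ℕ) (hp : Even p) (hp2 : 2 ≤ p) (t t' : ℝ) (ht : 0 < t) (ht' : 0 < t')
    (μ ν : Measure ℝ) (hμ : IsFreePoissonLaw p t μ) (hν : IsFreePoissonLaw p t' ν)
    (ρ : Measure ℝ) :
    IsTensorFreeConvolution p μ ν ρ ↔ IsFreePoissonLaw p (t + t') ρ := by
  have : NeZero p := ⟨by omega⟩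
  have key : ∀ Φ : TensorDistribution p (Fin 2), Φ.IsFree → (Φ.marginal 0).HasLaw μ →
      (Φ.marginal 1).HasLaw ν → (Φ.total.HasLaw ρ ↔ IsFreePoissonLaw p (t + t') ρ) := by
    intro Φ hΦ h0 h1
    refine TensorDistribution.hasLaw_iff_of_cumulantSeries hp ?_ ρ
    rw [TensorDistribution.cumulantSeries_total hp hΦ, h0.cumulantSeries_eq hp hμ,
      h1.cumulantSeries_eq hp hν, poissonSeries_add]
  have hex : ∃ Φ : TensorDistribution p (Fin 2),
      Φ.IsFree ∧ (Φ.marginal 0).HasLaw μ ∧ (Φ.marginal 1).HasLaw ν :=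
    ⟨TensorDistribution.poisson hp ![t, t'], TensorDistribution.poisson_isFree hp _,
      (TensorDistribution.hasLaw_iff_of_cumulantSeries hp
        (TensorDistribution.cumulantSeries_poisson hp ![t, t'] 0) μ).2 hμ,
      (TensorDistribution.hasLaw_iff_of_cumulantSeries hp
        (TensorDistribution.cumulantSeries_poisson hp ![t, t'] 1) ν).2 hν⟩
  constructor
  -- Any one free pair suffices to identify `ρ`, and the existence clause supplies it.
  · rintro ⟨⟨Φ, hΦ, h0, h1⟩, H⟩
    exact (key Φ hΦ h0 h1).1 (H Φ hΦ h0 h1)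
  · intro hρ
    exact ⟨hex, fun Φ hΦ h0 h1 => (key Φ hΦ h0 h1).2 hρ⟩
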